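/- Graphs are simple (undirected, loopless), not necessarily non-empty, and are viewed as structures for the first-order language with one binary relation symbol (adjacency); "countable" means finite or countably infinite. Let $\mathcal C$ be a finite set of connected finite (in particular non-empty) graphs. A graph $G$ *omits* $\mathcal C$ (is $\mathcal C$-free) if no subgraph of $G$, induced or not, is isomorphic to a member of $\mathcal C$; $\mathcal G_{\mathcal C}$ is the class of countable graphs omitting $\mathcal C$. An *existential* formula is one of the form $\exists y_1\cdots\exists y_k\,\theta$ with $\theta$ quantifier-free. A graph $G\in\mathcal G_{\mathcal C}$ is *existentially complete* if, whenever $G$ is an induced subgraph of some $H\in\mathcal G_{\mathcal C}$, every existential formula with parameters from $G$ that is true in $H$ is true in $G$. Let $\mathcal E_{\mathcal C}$ be the class of existentially complete graphs in $\mathcal G_{\mathcal C}$, and let $T^*_{\mathcal C}$ be the first-order theory of $\mathcal E_{\mathcal C}$, i.e. the set of sentences true in all graphs of $\mathcal E_{\mathcal C}$. For a sequence $\bar a$ of length $n$ in $G\in\mathcal E_{\mathcal C}$, its existential type $\mathrm{tp}_G(\bar a)$ is the set of existential formulas $\varphi(x_1,\dots,x_n)$ with $G\models\varphi(\bar a)$;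 $S_n(T^*_{\mathcal C})$ is the set of all types $\mathrm{tp}_G(\bar a)$ with $G\in\mathcal E_{\mathcal C}$ and $\bar a\in G^n$. For a model $M$ of $T^*_{\mathcal C}$ and $A\subseteq M$, $\mathrm{acl}(A)$ is the set of $b\in M$ for which there is an existential formula $\varphi(x,\bar a)$ with parameters $\bar a$ from $A$ such that $\{x\in M: M\models\varphi(x,\bar a)\}$ is finite and contains $b$. A theory is $\aleph_0$-*categorical* if it has a countable model, and only one up to isomorphism. **Theorem 3.** The following are equivalent: 1. $T^*_{\mathcal C}$ is $\aleph_0$-categorical. 2. $S_n(T^*_{\mathcal C})$ is finite for every $n\ge 0$. 3. For every model $M$ of $T^*_{\mathcal C}$ (of any cardinality) and every finite $A\subseteq M$, $\mathrm{acl}(A)$ is finite. These conditions imply: 4. $\mathcal G_{\mathcal C}$ contains a universal graph, i.e. a graph $G\in\mathcal G_{\mathcal C}$ such that every graph in $\mathcal G_{\mathcal C}$ is isomorphic to an induced subgraph of $G$. -/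

import Mathlib

open FirstOrder

namespace ForbiddenGraphs

/-- Finite (loopless, undirected) graphs, up to isomorphism: a graph on `{0, …, n - 1}`. -/
abbrev FiniteGraph : Type := Σ n : ℕ, SimpleGraph (Fin n)

/-- `G` omits `C`: no (not necessarily induced) subgraph of `G` is isomorphic to a member
of `C`. -/
def Omits (C : Set FiniteGraph) {V : Type*} (G : SimpleGraph V) : Prop :=
  ∀ F ∈ C, ¬ F.2.IsContained G

/-- The class `𝒢_C` of countable (finite or countably infinite) graphs omitting `C`. -/
def IsCountableFree (C : Set FiniteGraph) {V : Type} (G : SimpleGraph V) : Prop :=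
  Countable V ∧ Omits C G

/-- `G` is a universal graph of `𝒢_C`: every member of `𝒢_C` is isomorphic to an induced
subgraph of `G`. -/
def IsUniversalFree (C : Set FiniteGraph) {V : Type} (G : SimpleGraph V) : Prop :=
  IsCountableFree C G ∧
    ∀ (W : Type) (H : SimpleGraph W), IsCountableFree C H → Nonempty (H ↪g G)

/-- The formula `φ(a)` holds in the graph `G`. -/
def Sat {V : Type*} (G : SimpleGraph V) {n : ℕ} (φ : Language.graph.Formula (Fin n))
    (a : Fin n → V) : Prop :=
  letI := G.structure
  φ.Realize a

/-- The sentence `φ` holds in the graph `G`. -/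
def SatSentence {V : Type*} (G : SimpleGraph V) (φ : Language.graph.Sentence) : Prop :=
  letI := G.structure
  V ⊨ φ

/-- `G`, seen as an induced subgraph of `H` through `f`, is existentially complete in `H`: each
existential statement with parameters in `G` that is true in `H` is true in `G`. -/
def ExistentiallyCompleteIn {V W : Type*} {G : SimpleGraph V} {H : SimpleGraph W}
    (f : G ↪g H) : Prop :=
  ∀ (n : ℕ) (φ : Language.graph.Formula (Fin n)), φ.IsExistential →
    ∀ a : Fin n → V, Sat H φ (fun i => f (a i)) → Sat G φ a

/-- The class `ℰ_C` of existentially complete graphs in `𝒢_C`. -/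
def IsExistentiallyComplete (C : Set FiniteGraph) {V : Type} (G : SimpleGraph V) : Prop :=
  IsCountableFree C G ∧
    ∀ (W : Type) (H : SimpleGraph W) (f : G ↪g H), IsCountableFree C H →
      ExistentiallyCompleteIn f

/-- `T*_C`, the first-order theory of the class `ℰ_C`. -/
def TStar (C : Set FiniteGraph) : Language.graph.Theory :=
  {φ | ∀ (V : Type) (G : SimpleGraph V), IsExistentiallyComplete C G → SatSentence G φ}

/-- A theory is `ℵ₀`-categorical if it has a unique countable model, up to isomorphism. -/
def Aleph0Categorical (T : Language.graph.Theory) : Prop :=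
  (∃ (M : Type) (_ : Language.graph.Structure M), Countable M ∧ M ⊨ T) ∧
    ∀ (M N : Type) [Language.graph.Structure M] [Language.graph.Structure N],
      Countable M → Countable N → M ⊨ T → N ⊨ T → Nonempty (M ≃[Language.graph] N)

/-- The existential type of a finite sequence in a graph. -/
def existentialType {V : Type*} (G : SimpleGraph V) {n : ℕ} (a : Fin n → V) :
    Set (Language.graph.Formula (Fin n)) :=
  {φ | φ.IsExistential ∧ Sat G φ a}

/-- `S_n(T*_C)`: the set of existential types of sequences of length `n` in graphs of `ℰ_C`. -/
def typeSpace (C : Set FiniteGraph) (n : ℕ) : Set (Set (Language.graph.Formula (Fin n))) :=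
  {p | ∃ (V : Type) (G : SimpleGraph V) (a : Fin n → V),
    IsExistentiallyComplete C G ∧ p = existentialType G a}

/-- The algebraic closure of `A` in `M`: the elements `b` for which there is an existential
formula `φ(x, p)` with parameters `p` in `A` whose solution set in `M` is finite and
contains `b`. -/
def acl {M : Type*} [Language.graph.Structure M] (A : Set M) : Set M :=
  {b | ∃ (n : ℕ) (φ : Language.graph.Formula (Fin (n + 1))) (p : Fin n → M),
    φ.IsExistential ∧ (∀ i, p i ∈ A) ∧
      {x : M | φ.Realize (Fin.cons x p : Fin (n + 1) → M)}.Finite ∧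
      φ.Realize (Fin.cons b p : Fin (n + 1) → M)}

end ForbiddenGraphs

namespace ForbiddenGraphs

open Language

/-! Everything is read off from finite pieces. The existential type of `a` in `G` is contained in
that of `b` in `H` iff every finite piece of `G` embeds in `H` by a map sending `a` to `b`
(`existentialType_subset_iff`); this relation is `Loc`. It yields a countable `C`-free amalgam
inside an ultrapower of `H` (`exists_amalgam`), so types realized in existentially complete graphs
are maximal, and an inclusion between two of them is an equality
(`IsExistentiallyComplete.loc_symm`). The countable models of `TStar C` are exactly the
existentially complete graphs (`isExistentiallyComplete_of_model`): as `C` is finite, one formula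
about a tuple can ensure that a given finite piece may be glued freely over it.

2 → 1: with finitely many types, `Loc` extends one point at a time (`Loc.exists_cons`), and
back-and-forth applies. It starts because disjoint unions of `C`-free graphs are `C`-free, the
members of `C` being connected (`loc_elim0`).

1 → 2: if a type of the unique existentially complete graph were not isolated by a finite piece,
forcing would build an existentially complete graph omitting it (`exists_isolating`). Infinitely
many types would have a limit in an ultraproduct; the piece isolating the limit is present around
almost all of the tuples, so these share one type.

3 → 2: take such a limit `c` and a finite tuple `d` enumerating its algebraic closure. Over `d`,
finite configurations can be moved off any finite set (`exists_embOn_avoiding`). Hence a forbidden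
graph in the free amalgam of two of the approximating graphs, over their versions of `d`, would
already occur in one of them. So the amalgam is `C`-free and the two tuples have the same type.

2 → 3: an infinite closure of a finite set has infinitely many points of one type over it, hence
infinitely many solutions of a formula supposed to have finitely many.

1 → 4: every countable `C`-free graph embeds in an existentially complete one, and these are all
isomorphic. -/

/-- `e` restricted to `S` is an isomorphism onto an induced subgraph. -/
def EmbOn {V W : Type*} (G : SimpleGraph V) (H : SimpleGraph W) (S : Set V) (e : V → W) : Prop :=
  ∀ x ∈ S, ∀ y ∈ S, (e x = e y → x = y) ∧ (H.Adj (e x) (e y) ↔ G.Adj x y)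

/-- Every finite part of `G` embeds in `H` by a map taking the tuple `a` to the tuple `b`. -/
def Loc {ι V W : Type*} (G : SimpleGraph V) (a : ι → V) (H : SimpleGraph W) (b : ι → W) : Prop :=
  ∀ S : Set V, S.Finite → ∃ e : V → W, EmbOn G H S e ∧ ∀ i, e (a i) = b i

/-! ### Finite partial embeddings and the relation `Loc`. -/

section EmbOn

variable {V W X ι κ : Type*} {G : SimpleGraph V} {H : SimpleGraph W} {K : SimpleGraph X}

lemma EmbOn.mono {S T : Set V} {e : V → W} (h : EmbOn G H T e) (hST : S ⊆ T) : EmbOn G H S e :=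
  fun x hx y hy => h x (hST hx) y (hST hy)

lemma EmbOn.comp {S : Set V} {T : Set W} {e : V → W} {f : W → X} (hf : EmbOn H K T f)
    (he : EmbOn G H S e) (hT : ∀ x ∈ S, e x ∈ T) : EmbOn G K S (f ∘ e) := fun x hx y hy =>
  ⟨fun h => (he x hx y hy).1 ((hf _ (hT x hx) _ (hT y hy)).1 h),
    (hf _ (hT x hx) _ (hT y hy)).2.trans (he x hx y hy).2⟩

lemma EmbOn.injOn {S : Set V} {e : V → W} (h : EmbOn G H S e) : Set.InjOn e S :=
  fun x hx y hy => (h x hx y hy).1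

lemma embOn_of_embedding (f : G ↪g H) (S : Set V) : EmbOn G H S f :=
  fun _ _ _ _ => ⟨fun h => f.injective h, f.map_adj_iff⟩

lemma embOn_id (S : Set V) : EmbOn G G S id := fun _ _ _ _ => ⟨id, Iff.rfl⟩

lemma Loc.trans {a : ι → V} {b : ι → W} {c : ι → X} (h : Loc G a H b) (h' : Loc H b K c) :
    Loc G a K c := by
  intro S hS
  obtain ⟨e, he, hea⟩ := h S hS
  obtain ⟨f, hf, hfb⟩ := h' (e '' S) (hS.image e)
  exact ⟨f ∘ e, hf.comp he fun x hx => ⟨x, hx, rfl⟩, fun i => by simp [hea, hfb]⟩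

lemma loc_of_embedding (f : G ↪g H) (a : ι → V) : Loc G a H (f ∘ a) :=
  fun S _ => ⟨f, embOn_of_embedding f S, fun _ => rfl⟩

lemma Loc.reindex {a : ι → V} {b : ι → W} (h : Loc G a H b) (σ : κ → ι) :
    Loc G (a ∘ σ) H (b ∘ σ) := fun S hS => by
  obtain ⟨e, he, hea⟩ := h S hS
  exact ⟨e, he, fun i => hea _⟩

lemma Loc.eq_iff [Finite ι] {a : ι → V} {b : ι → W} (h : Loc G a H b) (i j : ι) :
    a i = a j ↔ b i = b j := by
  obtain ⟨e, he, hea⟩ := h (Set.range a) (Set.finite_range a)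
  rw [← hea, ← hea]
  exact ⟨congrArg e, (he _ ⟨i, rfl⟩ _ ⟨j, rfl⟩).1⟩

lemma Loc.adj_iff [Finite ι] {a : ι → V} {b : ι → W} (h : Loc G a H b) (i j : ι) :
    G.Adj (a i) (a j) ↔ H.Adj (b i) (b j) := by
  obtain ⟨e, he, hea⟩ := h (Set.range a) (Set.finite_range a)
  rw [← hea, ← hea]
  exact (he _ ⟨i, rfl⟩ _ ⟨j, rfl⟩).2.symm

end EmbOn

/-! ### Existential formulas and diagrams of finite pieces. -/

section Formulas

variable {α β : Type*}

lemma isExistential_exs {n : ℕ} {φ : Language.graph.BoundedFormula α n} (h : φ.IsExistential) :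
    φ.exs.IsExistential := by
  induction n with
  | zero => exact h
  | succ n ih => exact ih h.ex

lemma isExistential_iExs [Finite β] {φ : Language.graph.Formula (α ⊕ β)}
    (h : BoundedFormula.IsQF φ) : (Formula.iExs β φ).IsExistential :=
  isExistential_exs (BoundedFormula.IsExistential.of_isQF (h.relabel _))

lemma isQF_iInf [Finite β] {n : ℕ} {f : β → Language.graph.BoundedFormula α n}
    (h : ∀ b, (f b).IsQF) : (BoundedFormula.iInf f).IsQF := by
  simp only [BoundedFormula.iInf]
  generalize (@Finset.univ β (Fintype.ofFinite β)).toList = l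
  induction l with
  | nil => exact BoundedFormula.IsQF.top
  | cons b l ih => exact (h b).inf ih

/-- The atomic formula `u = v`. -/
def eqF (u v : α) : Language.graph.Formula α := (Term.var u).equal (Term.var v)

/-- The atomic formula saying that `u` and `v` are adjacent. -/
def adjF (u v : α) : Language.graph.Formula α := adj.formula₂ (Term.var u) (Term.var v)

lemma isQF_eqF (u v : α) : BoundedFormula.IsQF (eqF u v) :=
  BoundedFormula.IsAtomic.isQF (BoundedFormula.IsAtomic.equal _ _)

lemma isQF_adjF (u v : α) : BoundedFormula.IsQF (adjF u v) :=
  BoundedFormula.IsAtomic.isQF (BoundedFormula.IsAtomic.rel _ _)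

/-- The formula `φ` holds in the graph `G`, for an arbitrary set of variables. -/
def Holds {V : Type*} (G : SimpleGraph V) (φ : Language.graph.Formula α) (v : α → V) : Prop :=
  letI := G.structure
  φ.Realize v

variable {V : Type*} {G : SimpleGraph V}

lemma holds_eqF {u w : α} {v : α → V} : Holds G (eqF u w) v ↔ v u = v w := by
  let := G.structure
  exact Formula.realize_equal

lemma holds_adjF {u w : α} {v : α → V} : Holds G (adjF u w) v ↔ G.Adj (v u) (v w) := by
  let := G.structure
  exact Formula.realize_rel₂

lemma holds_not {φ : Language.graph.Formula α} {v : α → V} :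
    Holds G φ.not v ↔ ¬ Holds G φ v := by
  let := G.structure
  exact Formula.realize_not

lemma holds_top {v : α → V} : Holds G (⊤ : Language.graph.Formula α) v := by
  let := G.structure
  exact Formula.realize_top.2 trivial

lemma holds_inf {φ ψ : Language.graph.Formula α} {v : α → V} :
    Holds G (φ ⊓ ψ) v ↔ Holds G φ v ∧ Holds G ψ v := by
  let := G.structure
  exact Formula.realize_inf

lemma holds_imp {φ ψ : Language.graph.Formula α} {v : α → V} :
    Holds G (φ.imp ψ) v ↔ (Holds G φ v → Holds G ψ v) := by
  let := G.structure
  exact Formula.realize_imp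

lemma holds_iInf [Finite β] {f : β → Language.graph.Formula α} {v : α → V} :
    Holds G (Formula.iInf f) v ↔ ∀ b, Holds G (f b) v := by
  let := G.structure
  exact Formula.realize_iInf

lemma holds_iExs [Finite β] {φ : Language.graph.Formula (α ⊕ β)} {v : α → V} :
    Holds G (φ.iExs β) v ↔ ∃ w : β → V, Holds G φ (Sum.elim v w) := by
  let := G.structure
  exact Formula.realize_iExs

lemma holds_iAlls [Finite β] {φ : Language.graph.Formula (α ⊕ β)} {v : α → V} :
    Holds G (φ.iAlls β) v ↔ ∀ w : β → V, Holds G φ (Sum.elim v w) := by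
  let := G.structure
  exact Formula.realize_iAlls

open Classical in
/-- The formula `φ` or its negation, according to the truth value of `p`. -/
noncomputable def litF (p : Prop) (φ : Language.graph.Formula α) : Language.graph.Formula α :=
  if p then φ else φ.not

open Classical in
/-- The formula `φ` if `p` holds, and the true formula otherwise. -/
noncomputable def guardF (p : Prop) (φ : Language.graph.Formula α) : Language.graph.Formula α :=
  if p then φ else ⊤

lemma holds_litF {p : Prop} {φ : Language.graph.Formula α} {v : α → V} :
    Holds G (litF p φ) v ↔ (p ↔ Holds G φ v) := by
  unfold litF; split_ifs with h <;> simp [h, holds_not]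

lemma holds_guardF {p : Prop} {φ : Language.graph.Formula α} {v : α → V} :
    Holds G (guardF p φ) v ↔ (p → Holds G φ v) := by
  unfold guardF; split_ifs with h <;> simp [h, holds_top]

lemma isQF_litF {p : Prop} {φ : Language.graph.Formula α} (h : BoundedFormula.IsQF φ) :
    BoundedFormula.IsQF (litF p φ) := by
  unfold litF; split_ifs
  exacts [h, h.not]

/-- The formula saying that the variables `i ↦ u i` induce the same graph as the tuple `a`. -/
noncomputable def diagF [Finite β] (G : SimpleGraph V) (a : β → V) (u : β → α) :
    Language.graph.Formula α :=
  Formula.iInf fun p : β × β => litF (a p.1 = a p.2) (eqF (u p.1) (u p.2)) ⊓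
    litF (G.Adj (a p.1) (a p.2)) (adjF (u p.1) (u p.2))

lemma isQF_diagF [Finite β] (a : β → V) (u : β → α) : BoundedFormula.IsQF (diagF G a u) :=
  isQF_iInf fun _ => (isQF_litF (isQF_eqF _ _)).inf (isQF_litF (isQF_adjF _ _))

lemma holds_diagF {W : Type*} {H : SimpleGraph W} [Finite β] {a : β → V} {u : β → α} {v : α → W} :
    Holds H (diagF G a u) v ↔ ∀ i j, (a i = a j ↔ v (u i) = v (u j)) ∧
      (G.Adj (a i) (a j) ↔ H.Adj (v (u i)) (v (u j))) := by
  simp only [diagF, holds_iInf, holds_inf, holds_litF, holds_eqF, holds_adjF, Prod.forall]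

/-- The formula saying that the finite part `S` of `G` embeds by a map taking the tuple `a`
to the free variables. -/
noncomputable def embF [Finite α] (G : SimpleGraph V) (a : α → V) (S : Set V) [Finite S] :
    Language.graph.Formula α :=
  Formula.iExs S (diagF G (Sum.elim a ((↑) : S → V)) id)

lemma isExistential_embF [Finite α] (a : α → V) (S : Set V) [Finite S] :
    (embF G a S).IsExistential :=
  isExistential_iExs (isQF_diagF _ _)

/-- The diagram makes the witnesses a well-defined injective map on `S` and the tuple. Elsewhere the
total map `e` takes a default value, which is why `W` must be nonempty when `V` is. -/
lemma holds_embF {W : Type*} {H : SimpleGraph W} [Finite α] {a : α → V} {S : Set V} [Finite S]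
    {b : α → W} (hVW : Nonempty V → Nonempty W) : Holds H (embF G a S) b ↔
      ∃ e : V → W, EmbOn G H (S ∪ Set.range a) e ∧ ∀ i, e (a i) = b i := by
  simp only [embF, holds_iExs, holds_diagF, id]
  constructor
  · rintro ⟨w, hw⟩
    by_cases hne : Nonempty W
    · classical
      let g : α ⊕ S → V := Sum.elim a (↑)
      let e : V → W := fun x => if h : ∃ i, g i = x then Sum.elim b w h.choose else hne.some
      have he : ∀ i, e (g i) = Sum.elim b w i := fun i => by
        have h : ∃ j, g j = g i := ⟨i, rfl⟩
        simp only [e, dif_pos h]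
        exact (hw _ _).1.1 h.choose_spec
      have hr : S ∪ Set.range a ⊆ Set.range g := by
        rintro x (hx | ⟨i, rfl⟩)
        exacts [⟨.inr ⟨x, hx⟩, rfl⟩, ⟨.inl i, rfl⟩]
      refine ⟨e, ?_, fun i => he (.inl i)⟩
      intro x hx y hy
      obtain ⟨i, rfl⟩ := hr hx
      obtain ⟨j, rfl⟩ := hr hy
      rw [he, he]
      exact ⟨(hw i j).1.2, (hw i j).2.symm⟩
    · have hα : IsEmpty α := ⟨fun i => hne ⟨b i⟩⟩
      have hV : IsEmpty V := not_nonempty_iff.1 fun h => hne (hVW h)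
      exact ⟨isEmptyElim, fun x => isEmptyElim x, isEmptyElim⟩
  · rintro ⟨e, he, hea⟩
    refine ⟨fun x => e x, fun i j => ?_⟩
    have h : ∀ i, Sum.elim b (fun x : S => e x) i = e (Sum.elim a (↑) i) := by
      rintro (i | i) <;> simp [hea]
    have hm : ∀ i : α ⊕ S, Sum.elim a (↑) i ∈ S ∪ Set.range a := by
      rintro (i | i) <;> simp
    rw [h, h]
    exact ⟨⟨congrArg e, (he _ (hm i) _ (hm j)).1⟩, (he _ (hm i) _ (hm j)).2.symm⟩

lemma nonempty_of_holds_embF {W : Type*} {H : SimpleGraph W} [Finite α] {a : α → V} {S : Set V}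
    [Finite S] {b : α → W} (hS : S.Nonempty) (h : Holds H (embF G a S) b) : Nonempty W := by
  simp only [embF, holds_iExs] at h
  exact ⟨h.choose ⟨_, hS.some_mem⟩⟩

lemma realize_iff_of_isQF {W : Type*} {H : SimpleGraph W} {n : ℕ}
    {φ : Language.graph.BoundedFormula α n} (hφ : φ.IsQF) {v : α → V} {xs : Fin n → V} {e : V → W}
    (he : EmbOn G H (Set.range v ∪ Set.range xs) e) :
    @BoundedFormula.Realize _ _ G.structure _ _ φ v xs ↔
      @BoundedFormula.Realize _ _ H.structure _ _ φ (e ∘ v) (e ∘ xs) := by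
  let := G.structure
  let := H.structure
  have hmem : ∀ t : Language.graph.Term (α ⊕ Fin n),
      t.realize (Sum.elim v xs) ∈ Set.range v ∪ Set.range xs := by
    rintro ((i | i) | ⟨f, _⟩)
    · exact Or.inl ⟨i, rfl⟩
    · exact Or.inr ⟨i, rfl⟩
    · exact isEmptyElim f
  have hterm : ∀ t : Language.graph.Term (α ⊕ Fin n),
      t.realize (Sum.elim (e ∘ v) (e ∘ xs)) = e (t.realize (Sum.elim v xs)) := by
    rintro ((i | i) | ⟨f, _⟩)
    · rfl
    · rfl
    · exact isEmptyElim f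
  induction hφ with
  | falsum => exact Iff.rfl
  | imp _ _ ih₁ ih₂ => exact imp_congr ih₁ ih₂
  | of_isAtomic h =>
    cases h with
    | equal t₁ t₂ =>
      rw [BoundedFormula.realize_bdEqual, BoundedFormula.realize_bdEqual, hterm, hterm]
      exact ⟨congrArg e, (he _ (hmem t₁) _ (hmem t₂)).1⟩
    | rel R ts =>
      rw [BoundedFormula.realize_rel, BoundedFormula.realize_rel]
      simp only [hterm]
      cases R
      exact (he _ (hmem (ts 0)) _ (hmem (ts 1))).2.symm

/-- An existential formula true in `G` is true in every graph into which a suitable finite part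
of `G` embeds. -/
lemma exists_finite_witness [Finite α] {n : ℕ} {φ : Language.graph.BoundedFormula α n}
    (hφ : φ.IsExistential) {v : α → V} {xs : Fin n → V}
    (h : @BoundedFormula.Realize _ _ G.structure _ _ φ v xs) :
    ∃ S : Set V, S.Finite ∧ ∀ {W : Type*} (H : SimpleGraph W) (e : V → W), EmbOn G H S e →
      @BoundedFormula.Realize _ _ H.structure _ _ φ (e ∘ v) (e ∘ xs) := by
  induction hφ with
  | of_isQF hq =>
    exact ⟨_, (Set.finite_range v).union (Set.finite_range xs),
      fun H e he => (realize_iff_of_isQF hq he).1 h⟩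
  | ex _ ih =>
    let := G.structure
    obtain ⟨x, hx⟩ := BoundedFormula.realize_ex.1 h
    obtain ⟨S, hS, hSe⟩ := ih hx
    refine ⟨S, hS, fun H e he => ?_⟩
    let := H.structure
    refine BoundedFormula.realize_ex.2 ⟨e x, ?_⟩
    have := hSe H e he
    rwa [Fin.comp_snoc] at this

lemma exists_finite_witness_sat {n : ℕ} {φ : Language.graph.Formula (Fin n)}
    (hφ : φ.IsExistential) {v : Fin n → V} (h : Sat G φ v) :
    ∃ S : Set V, S.Finite ∧ ∀ {W : Type*} (H : SimpleGraph W) (e : V → W), EmbOn G H S e →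
      Sat H φ (e ∘ v) := by
  obtain ⟨S, hS, hSe⟩ := exists_finite_witness hφ h
  refine ⟨S, hS, fun H e he => ?_⟩
  have := hSe H e he
  rwa [Subsingleton.elim (e ∘ default) (default : Fin 0 → _)] at this

end Formulas

/-! ### Inclusion of existential types as `Loc`. -/

section Types

variable {V W : Type*} {G : SimpleGraph V} {H : SimpleGraph W} {n : ℕ}

lemma Loc.sat {a : Fin n → V} {b : Fin n → W} (h : Loc G a H b)
    {φ : Language.graph.Formula (Fin n)} (hφ : φ.IsExistential) (hs : Sat G φ a) : Sat H φ b := by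
  obtain ⟨S, hS, hSe⟩ := exists_finite_witness_sat hφ hs
  obtain ⟨e, he, hea⟩ := h S hS
  have := hSe H e he
  rwa [show e ∘ a = b from funext hea] at this

/-- The diagram of a finite piece is itself an existential formula, true in `G` through the
identity; a one-point piece supplies the nonemptiness of `W`. -/
lemma loc_of_forall_sat {a : Fin n → V} {b : Fin n → W}
    (h : ∀ φ : Language.graph.Formula (Fin n), φ.IsExistential → Sat G φ a → Sat H φ b) :
    Loc G a H b := by
  have key : ∀ S : Set V, S.Finite → ∀ [Finite S], Holds H (embF G a S) b := fun S hS _ =>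
    h _ (isExistential_embF a S) ((holds_embF id).2 ⟨id, embOn_id _, fun _ => rfl⟩)
  have hne : Nonempty V → Nonempty W := fun ⟨v⟩ =>
    nonempty_of_holds_embF (Set.singleton_nonempty v) (key {v} (Set.finite_singleton v))
  intro S hS
  have := hS.to_subtype
  obtain ⟨e, he, hea⟩ := (holds_embF hne).1 (key S hS)
  exact ⟨e, he.mono Set.subset_union_left, hea⟩

lemma existentialType_subset_iff {a : Fin n → V} {b : Fin n → W} :
    existentialType G a ⊆ existentialType H b ↔ Loc G a H b :=
  ⟨fun h => loc_of_forall_sat fun _ hφ hs => (h ⟨hφ, hs⟩).2,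
    fun h _ hφ => ⟨hφ.1, h.sat hφ.1 hφ.2⟩⟩

lemma existentialType_eq_iff {a : Fin n → V} {b : Fin n → W} :
    existentialType G a = existentialType H b ↔ Loc G a H b ∧ Loc H b G a := by
  rw [Set.Subset.antisymm_iff, existentialType_subset_iff, existentialType_subset_iff]

end Types

/-! ### Existential completeness in terms of `Loc`. -/

section ExistentiallyComplete

variable {C : Set FiniteGraph} {V : Type} {G : SimpleGraph V}

lemma IsExistentiallyComplete.loc (hG : IsExistentiallyComplete C G) {W : Type} {H : SimpleGraph W}
    (f : G ↪g H) (hH : IsCountableFree C H) {n : ℕ} (a : Fin n → V) : Loc H (f ∘ a) G a :=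
  loc_of_forall_sat fun φ hφ hs => hG.2 W H f hH n φ hφ a hs

lemma isExistentiallyComplete_of_loc (hG : IsCountableFree C G)
    (h : ∀ (W : Type) (H : SimpleGraph W) (f : G ↪g H), IsCountableFree C H →
      ∀ (n : ℕ) (a : Fin n → V), Loc H (f ∘ a) G a) : IsExistentiallyComplete C G :=
  ⟨hG, fun W H f hH n _ hφ a hs => (h W H f hH n a).sat hφ hs⟩

end ExistentiallyComplete

/-! ### Amalgamation in an ultrapower, and maximality of types. -/

section Amalgamation

lemma isContained_of_injective {V W : Type*} {F : SimpleGraph W} {G : SimpleGraph V} (h : W → V)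
    (hi : Function.Injective h) (hh : ∀ x y, F.Adj x y → G.Adj (h x) (h y)) : F.IsContained G :=
  ⟨⟨⟨h, fun {x y} => hh x y⟩, hi⟩⟩

lemma exists_injective_of_isContained {V W : Type*} {F : SimpleGraph W} {G : SimpleGraph V}
    (h : F.IsContained G) :
    ∃ h : W → V, Function.Injective h ∧ ∀ x y, F.Adj x y → G.Adj (h x) (h y) := by
  obtain ⟨f⟩ := h
  exact ⟨f, f.injective, fun x y hxy => f.toHom.map_adj hxy⟩

lemma Omits.of_embedding {C : Set FiniteGraph} {V W : Type*} {G : SimpleGraph V}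
    {H : SimpleGraph W} (hH : Omits C H) (f : G ↪g H) : Omits C G := by
  rintro F hF hc
  obtain ⟨h, hi, hh⟩ := exists_injective_of_isContained hc
  exact hH F hF (isContained_of_injective (f ∘ h) (f.injective.comp hi)
    fun x y hxy => f.map_adj_iff.2 (hh x y hxy))

/-- The ultrapower of a graph. -/
def germGraph {ι W : Type*} (U : Ultrafilter ι) (H : SimpleGraph W) :
    SimpleGraph (Filter.Germ (U : Filter ι) W) where
  Adj := Filter.Germ.LiftRel H.Adj
  symm := ⟨fun x y => Filter.Germ.inductionOn₂ x y fun _ _ h => h.mono fun _ hi => hi.symm⟩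
  loopless := ⟨fun x => Filter.Germ.inductionOn x fun _ h =>
    (h.exists).elim fun _ hi => H.loopless.irrefl _ hi⟩

/-- A copy of a finite graph in the ultrapower involves finitely many conditions, which hold
simultaneously at some index. -/
lemma omits_germGraph {C : Set FiniteGraph} {ι W : Type*} (U : Ultrafilter ι) {H : SimpleGraph W}
    (hH : Omits C H) : Omits C (germGraph U H) := by
  rintro F hF hc
  obtain ⟨h, hi, hh⟩ := exists_injective_of_isContained hc
  choose r hr using fun x => Quotient.exists_rep (h x)
  have hr' : ∀ x, h x = ((r x : ι → W) : Filter.Germ (U : Filter ι) W) := fun x => (hr x).symm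
  have h1 : ∀ᶠ i in (U : Filter ι), ∀ x y, F.2.Adj x y → H.Adj (r x i) (r y i) := by
    simp only [Filter.eventually_all]
    intro x y hxy
    have := hh x y hxy
    rw [hr', hr'] at this
    exact this
  have h2 : ∀ᶠ i in (U : Filter ι), ∀ x y, x ≠ y → r x i ≠ r y i := by
    simp only [Filter.eventually_all]
    intro x y hxy
    have : ¬ (h x = h y) := fun h => hxy (hi h)
    rw [hr', hr', Filter.Germ.coe_eq, Filter.EventuallyEq, ← Ultrafilter.eventually_not] at this
    exact this
  obtain ⟨i, hi1, hi2⟩ := (h1.and h2).exists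
  exact hH F hF (isContained_of_injective (fun x => r x i)
    (fun x y hxy => by_contra fun hne => hi2 x y hne hxy) hi1)

/-- The finite embeddings `e S` assemble into an embedding of `G` in an ultrapower of `H`, agreeing
along the tuples with the diagonal embedding of `H`. The union of the two images is countable. -/
lemma exists_amalgam {C : Set FiniteGraph} {ι V W : Type} {G : SimpleGraph V} {H : SimpleGraph W}
    [Countable V] (hH : IsCountableFree C H) {a : ι → V} {b : ι → W}
    (h : Loc G a H b) : ∃ (X : Type) (K : SimpleGraph X) (f : G ↪g K) (g : H ↪g K),
      IsCountableFree C K ∧ f ∘ a = g ∘ b := by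
  classical
  have := hH.1
  choose e he hea using fun S : Finset V => h S S.finite_toSet
  -- Finer than `atTop`, so that each vertex of `G` lies in almost every `S`.
  let U : Ultrafilter (Finset V) := Ultrafilter.of Filter.atTop
  have hU : ∀ v : V, ∀ᶠ S in (U : Filter (Finset V)), v ∈ S := fun v =>
    Ultrafilter.of_le Filter.atTop ((Filter.eventually_ge_atTop {v}).mono fun S hS => by
      simpa using hS)
  let f : G ↪g germGraph U H :=
    { toFun := fun v => ((fun S => e S v : Finset V → W) : Filter.Germ _ W)
      inj' := fun v w hvw => by
        rw [Filter.Germ.coe_eq] at hvw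
        obtain ⟨S, h1, h2, h3⟩ := (hvw.and ((hU v).and (hU w))).exists
        exact (he S v h2 w h3).1 h1
      map_rel_iff' := fun {v w} => by
        change (∀ᶠ S in (U : Filter (Finset V)), H.Adj (e S v) (e S w)) ↔ _
        have hev : ∀ᶠ S in (U : Filter (Finset V)), (H.Adj (e S v) (e S w) ↔ G.Adj v w) :=
          ((hU v).and (hU w)).mono fun S hS => (he S v hS.1 w hS.2).2
        rw [Filter.eventually_congr hev, Filter.eventually_const] }
  let g : H ↪g germGraph U H :=
    { toFun := fun w => ((fun _ => w : Finset V → W) : Filter.Germ _ W)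
      inj' := fun v w hvw => by
        rw [Filter.Germ.coe_eq] at hvw
        exact hvw.exists.choose_spec
      map_rel_iff' := fun {v w} => by
        change (∀ᶠ S in (U : Filter (Finset V)), H.Adj v w) ↔ _
        rw [Filter.eventually_const] }
  let s : Set (Filter.Germ (U : Filter (Finset V)) W) := Set.range f ∪ Set.range g
  refine ⟨s, (germGraph U H).induce s, ⟨⟨fun v => ⟨f v, Or.inl ⟨v, rfl⟩⟩, fun v w hvw =>
    f.injective (congrArg Subtype.val hvw)⟩, f.map_adj_iff⟩, ⟨⟨fun v => ⟨g v, Or.inr ⟨v, rfl⟩⟩,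
    fun v w hvw => g.injective (congrArg Subtype.val hvw)⟩, g.map_adj_iff⟩, ⟨?_, ?_⟩, ?_⟩
  · exact ((Set.countable_range f).union (Set.countable_range g)).to_subtype
  · exact (omits_germGraph U hH.2).of_embedding (SimpleGraph.Embedding.induce s)
  · funext i
    refine Subtype.ext ?_
    change f (a i) = g (b i)
    exact congrArg _ (funext fun S => hea S i)

/-- Existential types realized in existentially complete graphs are maximal. -/
lemma IsExistentiallyComplete.loc_symm {C : Set FiniteGraph} {V W : Type} {G : SimpleGraph V}
    {H : SimpleGraph W} (hG : IsExistentiallyComplete C G) (hH : IsCountableFree C H) {n : ℕ}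
    {a : Fin n → V} {b : Fin n → W} (h : Loc G a H b) : Loc H b G a := by
  have := hG.1.1
  obtain ⟨X, K, f, g, hK, hfg⟩ := exists_amalgam hH h
  have h1 := loc_of_embedding g b
  rw [← hfg] at h1
  exact h1.trans (hG.loc f hK a)

end Amalgamation

/-! ### Forcing existentially complete graphs, and omitting types. -/

section Generic

variable {C : Set FiniteGraph}

/-- The image of a graph under an injection, with isolated vertices added, omits `C`. -/
lemma omits_map (hconn : ∀ F ∈ C, F.2.Connected) (hC : ∀ F ∈ C, F.1 ≠ 1) {V W : Type*}
    {K : SimpleGraph V} (hK : Omits C K) (e : V ↪ W) : Omits C (K.map e) := by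
  rintro F hF hc
  obtain ⟨h, hi, hh⟩ := exists_injective_of_isContained hc
  have hcon := hconn F hF
  have h0 : F.1 ≠ 0 := fun h0 => by
    obtain ⟨x⟩ := hcon.nonempty
    exact absurd x.2 (by omega)
  have : Nontrivial (Fin F.1) := Fin.nontrivial_iff_two_le.2 (by have := hC F hF; omega)
  have hr : ∀ x, ∃ v, e v = h x := fun x => by
    obtain ⟨y, hy⟩ := hcon.preconnected.exists_adj_of_nontrivial x
    obtain ⟨v, _, _, hv, _⟩ := (SimpleGraph.map_adj e K _ _).1 (hh x y hy)
    exact ⟨v, hv⟩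
  choose r hr using hr
  refine hK F hF (isContained_of_injective r (fun x y hxy => hi ?_) fun x y hxy => ?_)
  · rw [← hr, ← hr, hxy]
  · have := hh x y hxy
    rwa [← hr, ← hr, SimpleGraph.map_adj_apply] at this

variable {W : Type}

/-- The vertices of `W` together with the first `n` new vertices. -/
def region (W : Type) (n : ℕ) : Set (W ⊕ ℕ) := {x | ∀ k, x = Sum.inr k → k < n}

lemma region_mono {m n : ℕ} (h : m ≤ n) : region W m ⊆ region W n :=
  fun _ hx k hk => (hx k hk).trans_le h

lemma inl_mem_region (w : W) (n : ℕ) : Sum.inl w ∈ region W n := fun _ h => nomatch h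

lemma exists_subset_region {S : Set (W ⊕ ℕ)} (hS : S.Finite) : ∃ n, S ⊆ region W n := by
  induction S, hS using Set.Finite.induction_on with
  | empty => exact ⟨0, Set.empty_subset _⟩
  | @insert x S _ _ ih =>
    obtain ⟨n, hn⟩ := ih
    rcases x with w | k
    · exact ⟨n, Set.insert_subset (inl_mem_region w n) hn⟩
    · refine ⟨max n (k + 1), Set.insert_subset (fun j hj => ?_)
        (hn.trans (region_mono (le_max_left _ _)))⟩
      cases hj
      exact lt_max_of_lt_right (Nat.lt_succ_self k)

/-- The graphs `K` and `L` agree on the first `n` new vertices. -/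
def Agree (n : ℕ) (K L : SimpleGraph (W ⊕ ℕ)) : Prop :=
  ∀ u ∈ region W n, ∀ v ∈ region W n, (K.Adj u v ↔ L.Adj u v)

lemma Agree.trans {n : ℕ} {K L M : SimpleGraph (W ⊕ ℕ)} (h : Agree n K L) (h' : Agree n L M) :
    Agree n K M := fun u hu v hv => (h u hu v hv).trans (h' u hu v hv)

lemma Agree.mono {m n : ℕ} {K L : SimpleGraph (W ⊕ ℕ)} (h : Agree n K L) (hmn : m ≤ n) :
    Agree m K L := fun u hu v hv => h u (region_mono hmn hu) v (region_mono hmn hv)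

/-- A forcing condition: the graph induced by `graph` on the first `size` new vertices. -/
structure Cond (C : Set FiniteGraph) (H : SimpleGraph W) where
  size : ℕ
  graph : SimpleGraph (W ⊕ ℕ)
  omits : Omits C graph
  extends_base : ∀ w w', graph.Adj (Sum.inl w) (Sum.inl w') ↔ H.Adj w w'

variable {H : SimpleGraph W}

/-- Only the edges inside the region are a commitment; the rest of `graph` just witnesses that the
commitment is consistent with being `C`-free. -/
instance : Preorder (Cond C H) where
  le p q := p.size ≤ q.size ∧ Agree p.size p.graph q.graph
  le_refl _ := ⟨le_rfl, fun _ _ _ _ => Iff.rfl⟩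
  le_trans _ _ _ h h' := ⟨h.1.trans h'.1, h.2.trans (h'.2.mono h.1)⟩

/-- The condition forced by the first `n` new vertices of a graph agreeing with `p`. -/
def Cond.ofAgree (p : Cond C H) (n : ℕ) (L : SimpleGraph (W ⊕ ℕ)) (hL : Omits C L)
    (h : Agree p.size p.graph L) : Cond C H where
  size := n
  graph := L
  omits := hL
  extends_base w w' := (h _ (inl_mem_region w _) _ (inl_mem_region w' _)).symm.trans
    (p.extends_base w w')

lemma Cond.le_ofAgree (p : Cond C H) {n : ℕ} {L : SimpleGraph (W ⊕ ℕ)} (hL : Omits C L)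
    (h : Agree p.size p.graph L) (hn : p.size ≤ n) : p ≤ p.ofAgree n L hL h :=
  ⟨hn, h⟩

lemma isCofinal_size_ge (n : ℕ) : IsCofinal {q : Cond C H | n ≤ q.size} := fun p =>
  ⟨p.ofAgree (max p.size n) p.graph p.omits fun _ _ _ _ => Iff.rfl,
    le_max_right p.size n, p.le_ofAgree _ _ (le_max_left _ _)⟩

/-- The generic graph is the union of the regions in a directed family meeting all the `D i`. A copy
of a member of `C` is finite, so it would lie in one region, where the generic graph agrees with a
`C`-free graph. -/
lemma exists_generic {ι : Type*} [Countable ι] (p₀ : Cond C H) (D : ι → Set (Cond C H))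
    (hD : ∀ i, IsCofinal (D i)) : ∃ G : SimpleGraph (W ⊕ ℕ), Omits C G ∧
      (∀ w w', G.Adj (Sum.inl w) (Sum.inl w') ↔ H.Adj w w') ∧
      ∀ i, ∃ q ∈ D i, Agree q.size q.graph G := by
  have : Encodable (ι ⊕ ℕ) := Encodable.ofCountable _
  let 𝒟 : ι ⊕ ℕ → Order.Cofinal (Cond C H) :=
    Sum.elim (fun i => ⟨D i, hD i⟩) fun n => ⟨_, isCofinal_size_ge n⟩
  let I := Order.idealOfCofinals p₀ 𝒟
  let G : SimpleGraph (W ⊕ ℕ) :=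
    { Adj := fun u v => ∃ q ∈ I, u ∈ region W q.size ∧ v ∈ region W q.size ∧ q.graph.Adj u v
      symm := ⟨fun u v ⟨q, hq, hu, hv, h⟩ => ⟨q, hq, hv, hu, h.symm⟩⟩
      loopless := ⟨fun u ⟨q, _, _, _, h⟩ => q.graph.loopless.irrefl _ h⟩ }
  have hag : ∀ q ∈ I, Agree q.size q.graph G := fun q hq u hu v hv => by
    refine ⟨fun h => ⟨q, hq, hu, hv, h⟩, ?_⟩
    rintro ⟨q', hq', hu', hv', h⟩
    obtain ⟨r, -, hr, hr'⟩ := I.directed q hq q' hq'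
    exact (hr.2 u hu v hv).2 ((hr'.2 u hu' v hv').1 h)
  refine ⟨G, ?_, fun w w' => ?_, fun i => ?_⟩
  · rintro F hF hc
    obtain ⟨h, hi, hh⟩ := exists_injective_of_isContained hc
    obtain ⟨n, hn⟩ := exists_subset_region (Set.finite_range h)
    obtain ⟨q, hq, hqI⟩ := Order.cofinal_meets_idealOfCofinals p₀ 𝒟 (Sum.inr n)
    have hm : ∀ x, h x ∈ region W q.size := fun x => region_mono hq (hn ⟨x, rfl⟩)
    exact q.omits F hF (isContained_of_injective h hi fun x y hxy =>
      (hag q hqI _ (hm x) _ (hm y)).2 (hh x y hxy))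
  · rw [← hag p₀ (Order.mem_idealOfCofinals p₀ 𝒟) _ (inl_mem_region w _) _ (inl_mem_region w' _)]
    exact p₀.extends_base w w'
  · obtain ⟨q, hq, hqI⟩ := Order.cofinal_meets_idealOfCofinals p₀ 𝒟 (Sum.inl i)
    exact ⟨q, hq, hag q hqI⟩

/-- Turns an arbitrary countable extension of a region into a graph that a condition can use:
vertices of `Y` coming from the region return to their places, the others are sent beyond it. Unused
places become isolated vertices, which is harmless by `omits_map`. -/
lemma exists_pullback (hconn : ∀ F ∈ C, F.2.Connected) (hC : ∀ F ∈ C, F.1 ≠ 1) {Y : Type*}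
    [Countable Y] {K : SimpleGraph Y} (hK : Omits C K) {L₀ : SimpleGraph (W ⊕ ℕ)} {n : ℕ}
    {g : W ⊕ ℕ → Y} (hg : EmbOn L₀ K (region W n) g) :
    ∃ L : SimpleGraph (W ⊕ ℕ), Omits C L ∧ Agree n L₀ L ∧
      ∃ e : K ↪g L, ∀ x ∈ region W n, e (g x) = x := by
  classical
  obtain ⟨enc, henc⟩ := exists_injective_nat Y
  let e : Y → W ⊕ ℕ := fun y =>
    if h : ∃ x ∈ region W n, g x = y then h.choose else Sum.inr (n + enc y)
  have he1 : ∀ x ∈ region W n, e (g x) = x := fun x hx => by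
    have h : ∃ z ∈ region W n, g z = g x := ⟨x, hx, rfl⟩
    simp only [e, dif_pos h]
    exact hg.injOn h.choose_spec.1 hx h.choose_spec.2
  have he2 : ∀ y, (¬ ∃ x ∈ region W n, g x = y) → e y = Sum.inr (n + enc y) := fun y hy => by
    simp only [e, dif_neg hy]
  have hnot : ∀ k, (Sum.inr (n + k) : W ⊕ ℕ) ∉ region W n := fun k h => by
    have := h _ rfl; omega
  have hinj : Function.Injective e := by
    intro y y' h
    by_cases hy : ∃ x ∈ region W n, g x = y <;> by_cases hy' : ∃ x ∈ region W n, g x = y'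
    · obtain ⟨x, hx, rfl⟩ := hy
      obtain ⟨x', hx', rfl⟩ := hy'
      rw [he1 x hx, he1 x' hx'] at h
      rw [h]
    · obtain ⟨x, hx, rfl⟩ := hy
      rw [he1 x hx, he2 _ hy'] at h
      exact absurd (h ▸ hx) (hnot _)
    · obtain ⟨x, hx, rfl⟩ := hy'
      rw [he1 x hx, he2 _ hy] at h
      exact absurd (h.symm ▸ hx) (hnot _)
    · rw [he2 _ hy, he2 _ hy'] at h
      exact henc (by simpa using h)
  let E : Y ↪ W ⊕ ℕ := ⟨e, hinj⟩
  refine ⟨K.map E, omits_map hconn hC hK E, fun u hu v hv => ?_,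
    SimpleGraph.Embedding.map E K, he1⟩
  have := SimpleGraph.map_adj_apply (G := K) (f := E) (a := g u) (b := g v)
  rw [show E (g u) = u from he1 u hu, show E (g v) = v from he1 v hv] at this
  rw [this]
  exact (hg u hu v hv).2.symm

/-- A finite graph with marked vertices, and the intended places of the marked vertices. -/
abbrev Task (V : Type) : Type :=
  Σ n : ℕ, Σ m : ℕ, SimpleGraph (Fin m) × (Fin n → V) × (Fin n → Fin m)

/-- The finite graph of the task `t` embeds in `L` with its marked vertices at the given places. -/
def Solves {V : Type} (L : SimpleGraph V) (t : Task V) : Prop :=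
  ∃ e : Fin t.2.1 → V, EmbOn t.2.2.1 L Set.univ e ∧ ∀ i, e (t.2.2.2.2 i) = t.2.2.2.1 i

/-- The conditions that decide whether the task `t` is solved. -/
def deciding (H : SimpleGraph W) (C : Set FiniteGraph) (t : Task (W ⊕ ℕ)) : Set (Cond C H) :=
  {q | Set.range t.2.2.2.1 ⊆ region W q.size ∧
    ((∀ L, Omits C L → Agree q.size q.graph L → Solves L t) ∨
      ∀ L, Omits C L → Agree q.size q.graph L → ¬ Solves L t)}

/-- If some graph compatible with the condition solves the task, enlarging the region to contain
that finite solution forces it. -/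
lemma isCofinal_deciding (t : Task (W ⊕ ℕ)) : IsCofinal (deciding H C t) := by
  intro p
  obtain ⟨n, hn⟩ := exists_subset_region (Set.finite_range t.2.2.2.1)
  obtain ⟨q, hq, hpq⟩ := isCofinal_size_ge (C := C) (H := H) n p
  by_cases h : ∀ L, Omits C L → Agree q.size q.graph L → ¬ Solves L t
  · exact ⟨q, ⟨hn.trans (region_mono hq), Or.inr h⟩, hpq⟩
  · push Not at h
    obtain ⟨L, hL, hag, e, he, hem⟩ := h
    obtain ⟨k, hk⟩ := exists_subset_region (Set.finite_range e)
    refine ⟨q.ofAgree (max q.size k) L hL hag, ⟨hn.trans (region_mono (hq.trans (le_max_left _ _))),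
      Or.inl fun L' _ hag' => ⟨e, fun x hx y hy => ⟨(he x hx y hy).1, ?_⟩, hem⟩⟩,
      hpq.trans (q.le_ofAgree _ _ (le_max_left _ _))⟩
    have hm : ∀ x, e x ∈ region W (max q.size k) := fun x =>
      region_mono (le_max_right _ _) (hk ⟨x, rfl⟩)
    rw [← (he x hx y hy).2]
    exact (hag' _ (hm x) _ (hm y)).symm

/-- A finite piece of an extension `K` is a task over the tuple. A condition met by `G` decides it,
and cannot decide it negatively, because `K` pulls back to a compatible graph solving it. -/
lemma isExistentiallyComplete_of_generic [Countable W] (hconn : ∀ F ∈ C, F.2.Connected)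
    (hC : ∀ F ∈ C, F.1 ≠ 1) {G : SimpleGraph (W ⊕ ℕ)} (hG : Omits C G)
    (hgen : ∀ t, ∃ q ∈ deciding H C t, Agree q.size q.graph G) : IsExistentiallyComplete C G := by
  classical
  refine isExistentiallyComplete_of_loc ⟨inferInstance, hG⟩ fun Y K f hK n a S hS => ?_
  have := hK.1
  have hS' : (S ∪ Set.range (f ∘ a)).Finite := hS.union (Set.finite_range _)
  set S' := S ∪ Set.range (f ∘ a) with hS'def
  have := hS'.to_subtype
  obtain ⟨m, ⟨σ⟩⟩ := Finite.exists_equiv_fin S'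
  have hfa : ∀ i, f (a i) ∈ S' := fun i => Or.inr ⟨i, rfl⟩
  let t : Task (W ⊕ ℕ) := ⟨n, m, K.comap fun i => (σ.symm i : Y), a, fun i => σ ⟨f (a i), hfa i⟩⟩
  obtain ⟨q, ⟨hreg, hq⟩, hag⟩ := hgen t
  have hsolve : Solves G t := by
    rcases hq with hq | hq
    · exact hq G hG hag
    · obtain ⟨L, hL, hGL, e, he⟩ := exists_pullback hconn hC hK.2
        (embOn_of_embedding f (region W q.size))
      refine absurd ⟨fun i => e (σ.symm i : Y), fun x _ y _ => ⟨fun h => ?_, e.map_adj_iff⟩,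
        fun i => ?_⟩ (hq L hL (hag.trans hGL))
      · exact σ.symm.injective (Subtype.ext (e.injective h))
      · change e (σ.symm (σ ⟨f (a i), hfa i⟩) : Y) = a i
        rw [Equiv.symm_apply_apply]
        exact he _ (hreg ⟨i, rfl⟩)
  obtain ⟨e, he, hem⟩ := hsolve
  -- The value `Sum.inr 0` off `S'` is arbitrary.
  refine ⟨fun y => if h : y ∈ S' then e (σ ⟨y, h⟩) else Sum.inr 0, fun x hx y hy => ?_,
    fun i => ?_⟩
  · have hx' : x ∈ S' := Or.inl hx
    have hy' : y ∈ S' := Or.inl hy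
    simp only [dif_pos hx', dif_pos hy']
    refine ⟨fun h => ?_, ?_⟩
    · exact congrArg Subtype.val (σ.injective ((he _ trivial _ trivial).1 h))
    · refine (he _ trivial _ trivial).2.trans ?_
      change K.Adj (σ.symm (σ _) : Y) (σ.symm (σ _) : Y) ↔ _
      rw [Equiv.symm_apply_apply, Equiv.symm_apply_apply]
  · change (if h : f (a i) ∈ S' then e (σ ⟨f (a i), h⟩) else Sum.inr 0) = a i
    rw [dif_pos (hfa i)]
    exact hem i

lemma exists_existentiallyComplete_generic [Countable W] (hconn : ∀ F ∈ C, F.2.Connected)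
    (hC : ∀ F ∈ C, F.1 ≠ 1) (hH : Omits C H) {ι : Type*} [Countable ι] (D : ι → Set (Cond C H))
    (hD : ∀ i, IsCofinal (D i)) : ∃ G : SimpleGraph (W ⊕ ℕ), IsExistentiallyComplete C G ∧
      (∀ w w', G.Adj (Sum.inl w) (Sum.inl w') ↔ H.Adj w w') ∧
      ∀ i, ∃ q ∈ D i, Agree q.size q.graph G := by
  let p₀ : Cond C H := ⟨0, H.map Function.Embedding.inl, omits_map hconn hC hH _,
    fun _ _ => SimpleGraph.map_adj_apply⟩
  obtain ⟨G, hG, hGH, hgen⟩ := exists_generic p₀ (Sum.elim D fun t => deciding H C t) (by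
    rintro (i | t)
    exacts [hD i, isCofinal_deciding t])
  exact ⟨G, isExistentiallyComplete_of_generic hconn hC hG fun t => hgen (Sum.inr t), hGH,
    fun i => hgen (Sum.inl i)⟩

lemma isEmpty_of_omits {V : Type*} {G : SimpleGraph V} (hG : Omits C G)
    (h : ∃ F ∈ C, F.1 = 1) : IsEmpty V := by
  obtain ⟨⟨n, F⟩, hF, rfl : n = 1⟩ := h
  refine ⟨fun v => hG _ hF (isContained_of_injective (fun _ => v)
    (Function.injective_of_subsingleton _) fun x y hxy => ?_)⟩
  exact absurd (Subsingleton.elim x y) hxy.ne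

/-- Every countable `C`-free graph embeds in an existentially complete one. -/
lemma exists_existentiallyComplete_extension (hconn : ∀ F ∈ C, F.2.Connected)
    (hH : IsCountableFree C H) :
    ∃ (V : Type) (G : SimpleGraph V), IsExistentiallyComplete C G ∧ Nonempty (H ↪g G) := by
  have := hH.1
  by_cases hC : ∃ F ∈ C, F.1 = 1
  · have := isEmpty_of_omits hH.2 hC
    refine ⟨W, H, isExistentiallyComplete_of_loc hH fun Y K f hK n a S _ => ?_,
      ⟨SimpleGraph.Embedding.refl⟩⟩
    have := isEmpty_of_omits hK.2 hC
    exact ⟨isEmptyElim, fun x => isEmptyElim x, fun i => isEmptyElim (a i)⟩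
  · push Not at hC
    obtain ⟨G, hG, hGH, -⟩ := exists_existentiallyComplete_generic hconn hC hH.2
      (ι := Empty) Empty.elim Empty.rec
    exact ⟨_, G, hG, ⟨⟨Function.Embedding.inl, hGH _ _⟩⟩⟩

/-- Adding an isolated vertex keeps the graph `C`-free, and the existence of a vertex then reflects
back to `G`. -/
lemma IsExistentiallyComplete.nonempty (hconn : ∀ F ∈ C, F.2.Connected) (hC : ∀ F ∈ C, F.1 ≠ 1)
    {V : Type} {G : SimpleGraph V} (hG : IsExistentiallyComplete C G) : Nonempty V := by
  have := hG.1.1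
  obtain ⟨e, -, -⟩ := hG.loc (SimpleGraph.Embedding.map Function.Embedding.some G)
    ⟨inferInstance, omits_map hconn hC hG.1.2 _⟩ (n := 0) Fin.elim0 ∅ Set.finite_empty
  exact ⟨e none⟩

/-- If all existentially complete graphs are isomorphic, then every existential type is isolated
by the isomorphism type of a finite graph. -/
lemma exists_isolating (hconn : ∀ F ∈ C, F.2.Connected) {V : Type} {M : SimpleGraph V}
    {n : ℕ} (b : Fin n → V)
    (hiso : ∀ (W : Type) (G : SimpleGraph W), IsExistentiallyComplete C G → Nonempty (M ≃g G)) :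
    ∃ S : Set V, S.Finite ∧ ∀ (W : Type) (G : SimpleGraph W) (c : Fin n → W),
      IsExistentiallyComplete C G → (∃ e, EmbOn M G S e ∧ ∀ i, e (b i) = c i) → Loc G c M b := by
  by_cases hC : ∃ F ∈ C, F.1 = 1
  · refine ⟨∅, Set.finite_empty, fun W G c hG _ S _ => ?_⟩
    have := isEmpty_of_omits hG.1.2 hC
    exact ⟨isEmptyElim, fun x => isEmptyElim x, fun i => isEmptyElim (c i)⟩
  push Not at hC
  by_contra hcon
  push Not at hcon
  have hbot : Omits C (⊥ : SimpleGraph Empty) := by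
    rintro F hF hc
    obtain ⟨h, -⟩ := exists_injective_of_isContained hc
    exact (h (hconn F hF).nonempty.some).elim
  -- Conditions forcing the tuple `a` not to realize a type contained in that of `b`. Over an empty
  -- base all regions are finite.
  let D : (Fin n → Empty ⊕ ℕ) → Set (Cond C (⊥ : SimpleGraph Empty)) := fun a =>
    {q | ∀ L, Omits C L → Agree q.size q.graph L → ¬ Loc L a M b}
  have hD : ∀ a, IsCofinal (D a) := by
    intro a p
    obtain ⟨k, hk⟩ := exists_subset_region (Set.finite_range a)
    obtain ⟨q, hq, hpq⟩ := isCofinal_size_ge (C := C) (H := (⊥ : SimpleGraph Empty)) k p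
    have ha : ∀ i, a i ∈ region Empty q.size := fun i => region_mono hq (hk ⟨i, rfl⟩)
    obtain ⟨L, hL, hag, hloc⟩ : ∃ L, Omits C L ∧ Agree q.size q.graph L ∧ ¬ Loc L a M b := by
      by_cases hloc : Loc q.graph a M b
      · have hfin : (region Empty q.size).Finite := by
          refine ((Set.finite_lt_nat q.size).image Sum.inr).subset ?_
          rintro (x | x) hx
          exacts [x.elim, ⟨x, hx x rfl, rfl⟩]
        obtain ⟨e₁, he₁, hea⟩ := hloc _ hfin
        -- The finite image of the region in `M` does not isolate the type, so some `G` contains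
        -- this piece around a tuple `c` of another type. Pulling `G` back places `c` at `a`.
        obtain ⟨Y, G, c, hG, ⟨e₂, he₂, heb⟩, hn⟩ := hcon _ (hfin.image e₁)
        have := hG.1.1
        obtain ⟨L, hL, hag, e, he⟩ := exists_pullback hconn hC hG.1.2
          (he₂.comp he₁ fun x hx => ⟨x, hx, rfl⟩)
        refine ⟨L, hL, hag, fun hl => hn ?_⟩
        have hc : e ∘ c = a := funext fun i => by
          rw [← he (a i) (ha i)]
          simp [hea, heb]
        have := loc_of_embedding e c
        rw [hc] at this
        exact this.trans hl
      · exact ⟨q.graph, q.omits, fun _ _ _ _ => Iff.rfl, hloc⟩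
    -- Failure of `Loc` is witnessed by a finite set; once the region contains it, the failure is
    -- forced.
    unfold Loc at hloc
    push Not at hloc
    obtain ⟨S, hS, hSe⟩ := hloc
    obtain ⟨j, hj⟩ := exists_subset_region hS
    refine ⟨q.ofAgree (max q.size j) L hL hag, fun L' _ hag' hl => ?_,
      hpq.trans (q.le_ofAgree _ _ (le_max_left _ _))⟩
    obtain ⟨e, he, hea⟩ := hl S hS
    obtain ⟨i, hi⟩ := hSe e fun x hx y hy => ⟨(he x hx y hy).1, (he x hx y hy).2.trans
      (hag' _ (region_mono (le_max_right _ _) (hj hx)) _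
        (region_mono (le_max_right _ _) (hj hy))).symm⟩
    exact hi (hea i)
  obtain ⟨G, hG, -, hgen⟩ := exists_existentiallyComplete_generic hconn hC hbot D hD
  obtain ⟨φ⟩ := hiso _ G hG
  obtain ⟨q, hq, hag⟩ := hgen (φ ∘ b)
  refine hq G hG.1.2 hag ?_
  have := loc_of_embedding φ.symm.toEmbedding (φ ∘ b)
  rwa [show φ.symm.toEmbedding ∘ (φ ∘ b) = b from funext fun i => φ.symm_apply_apply _] at this

end Generic

/-! ### Free amalgams and the parts of forbidden graphs. -/

section FreeAmalgam

/-- The tuples `a` and `b` induce the same graph. -/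
def SameDiag {ι V W : Type*} (G : SimpleGraph V) (a : ι → V) (H : SimpleGraph W) (b : ι → W) :
    Prop :=
  ∀ i j, (a i = a j ↔ b i = b j) ∧ (G.Adj (a i) (a j) ↔ H.Adj (b i) (b j))

variable {ι V W : Type*} {G : SimpleGraph V} {a : ι → V} {H : SimpleGraph W} {b : ι → W}

open Classical in
/-- The map of the second factor to the free amalgam. -/
noncomputable def glue (a : ι → V) (b : ι → W) (w : W) : V ⊕ {w : W // w ∉ Set.range b} :=
  if h : ∃ i, b i = w then Sum.inl (a h.choose) else Sum.inr ⟨w, fun ⟨i, hi⟩ => h ⟨i, hi⟩⟩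

/-- The free amalgam of two graphs over the tuples `a` and `b`. -/
noncomputable def freeAmalgam (G : SimpleGraph V) (a : ι → V) (H : SimpleGraph W) (b : ι → W) :
    SimpleGraph (V ⊕ {w : W // w ∉ Set.range b}) :=
  G.map Sum.inl ⊔ H.map (glue a b)

lemma freeAmalgam_adj {p q : V ⊕ {w : W // w ∉ Set.range b}} : (freeAmalgam G a H b).Adj p q ↔
    p ≠ q ∧ ((∃ v v', G.Adj v v' ∧ Sum.inl v = p ∧ Sum.inl v' = q) ∨
      ∃ w w', H.Adj w w' ∧ glue a b w = p ∧ glue a b w' = q) := by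
  rw [freeAmalgam, SimpleGraph.sup_adj, SimpleGraph.map_adj', SimpleGraph.map_adj', and_or_left]

namespace SameDiag

lemma glue_apply (h : SameDiag G a H b) (i : ι) : glue a b (b i) = Sum.inl (a i) := by
  have hex : ∃ j, b j = b i := ⟨i, rfl⟩
  rw [glue, dif_pos hex]
  exact congrArg _ ((h _ _).1.2 hex.choose_spec)

lemma glue_eq_inl (h : SameDiag G a H b) {w : W} {v : V} : glue a b w = Sum.inl v ↔ ∃ i, w = b i ∧ v = a i := by
  constructor
  · intro hw
    by_cases hex : ∃ j, b j = w
    · obtain ⟨i, rfl⟩ := hex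
      rw [h.glue_apply] at hw
      exact ⟨i, rfl, (Sum.inl_injective hw).symm⟩
    · rw [glue, dif_neg hex] at hw
      cases hw
  · rintro ⟨i, rfl, rfl⟩
    exact h.glue_apply i

lemma glue_injective (h : SameDiag G a H b) : Function.Injective (glue a b) := by
  intro w w' hw
  by_cases hex : ∃ j, b j = w
  · obtain ⟨i, rfl⟩ := hex
    rw [h.glue_apply] at hw
    obtain ⟨j, rfl, hj⟩ := h.glue_eq_inl.1 hw.symm
    exact (h i j).1.1 hj
  · by_cases hex' : ∃ j, b j = w'
    · obtain ⟨i, rfl⟩ := hex'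
      rw [h.glue_apply] at hw
      obtain ⟨j, rfl, hj⟩ := h.glue_eq_inl.1 hw
      exact absurd ⟨j, rfl⟩ hex
    · rw [glue, glue, dif_neg hex, dif_neg hex'] at hw
      exact congrArg Subtype.val (Sum.inr_injective hw)

lemma adj_inl_iff (h : SameDiag G a H b) {v v' : V} :
    (freeAmalgam G a H b).Adj (Sum.inl v) (Sum.inl v') ↔ G.Adj v v' := by
  rw [freeAmalgam_adj]
  constructor
  · rintro ⟨-, ⟨x, x', hx, hv, hv'⟩ | ⟨w, w', hw, hv, hv'⟩⟩
    · rwa [← Sum.inl_injective hv, ← Sum.inl_injective hv']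
    · obtain ⟨i, rfl, rfl⟩ := h.glue_eq_inl.1 hv
      obtain ⟨j, rfl, rfl⟩ := h.glue_eq_inl.1 hv'
      exact (h i j).2.2 hw
  · exact fun hv => ⟨fun he => hv.ne (Sum.inl_injective he), Or.inl ⟨v, v', hv, rfl, rfl⟩⟩

lemma adj_glue_iff (h : SameDiag G a H b) {w w' : W} :
    (freeAmalgam G a H b).Adj (glue a b w) (glue a b w') ↔ H.Adj w w' := by
  rw [freeAmalgam_adj]
  constructor
  · rintro ⟨-, ⟨x, x', hx, hv, hv'⟩ | ⟨y, y', hw, hv, hv'⟩⟩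
    · obtain ⟨i, rfl, rfl⟩ := h.glue_eq_inl.1 hv.symm
      obtain ⟨j, rfl, rfl⟩ := h.glue_eq_inl.1 hv'.symm
      exact (h i j).2.1 hx
    · rwa [← h.glue_injective hv, ← h.glue_injective hv']
  · exact fun hw => ⟨fun he => hw.ne (h.glue_injective he), Or.inr ⟨w, w', hw, rfl, rfl⟩⟩

/-- The embedding of the first factor. -/
noncomputable def inlEmbedding (h : SameDiag G a H b) : G ↪g freeAmalgam G a H b :=
  ⟨⟨Sum.inl, Sum.inl_injective⟩, h.adj_inl_iff⟩

/-- The embedding of the second factor. -/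
noncomputable def glueEmbedding (h : SameDiag G a H b) : H ↪g freeAmalgam G a H b :=
  ⟨⟨glue a b, h.glue_injective⟩, h.adj_glue_iff⟩

lemma inl_comp_eq (h : SameDiag G a H b) : h.inlEmbedding ∘ a = h.glueEmbedding ∘ b :=
  funext fun i => (h.glue_apply i).symm

end SameDiag

variable {X : Type*}

/-- The vertices of a graph that are labelled as lying in the part `s` or at a marked place. -/
abbrev side (l : X → ι ⊕ Bool) (s : Bool) : Type _ := {x : X // l x ≠ Sum.inr (!s)}

/-- `h` maps the part `s` of `F` injectively and homomorphically to `G`, taking exactly the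
vertices labelled by indices to the tuple `a`, in accordance with their labels. -/
def Realizes (F : SimpleGraph X) (l : X → ι ⊕ Bool) (s : Bool) (G : SimpleGraph V) (a : ι → V)
    (h : side l s → V) : Prop :=
  (∀ x y, x ≠ y → h x ≠ h y) ∧ (∀ x y : side l s, F.Adj x y → G.Adj (h x) (h y)) ∧
    (∀ (x : side l s) i, l x = Sum.inl i → h x = a i) ∧
    ∀ (x : side l s) i, l x = Sum.inr s → h x ≠ a i

lemma Realizes.map {F : SimpleGraph X} {l : X → ι ⊕ Bool} {s : Bool} {h : side l s → V}
    (hh : Realizes F l s G a h) (f : G ↪g H) : Realizes F l s H (f ∘ a) (f ∘ h) :=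
  ⟨fun x y hxy he => hh.1 x y hxy (f.injective he), fun x y hxy => f.map_adj_iff.2 (hh.2.1 x y hxy),
    fun x i hx => congrArg f (hh.2.2.1 x i hx), fun x i hx he => hh.2.2.2 x i hx (f.injective he)⟩

/-- Label each vertex of the copy by its place on the tuple or by the factor owning it; no edge of
the free amalgam joins the private parts of the two factors. -/
lemma exists_realizes_of_isContained (hd : SameDiag G a H b) {F : SimpleGraph X}
    (hF : F.IsContained (freeAmalgam G a H b)) :
    ∃ (l : X → ι ⊕ Bool) (h₁ : side l false → V) (h₂ : side l true → W),
      Realizes F l false G a h₁ ∧ Realizes F l true H b h₂ ∧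
        ∀ x y, F.Adj x y → l x = Sum.inr true → l y ≠ Sum.inr false := by
  classical
  obtain ⟨f, hfi, hf⟩ := exists_injective_of_isContained hF
  let l : X → ι ⊕ Bool := fun x =>
    if h : ∃ i, f x = Sum.inl (a i) then Sum.inl h.choose else
      if (f x).isLeft then Sum.inr false else Sum.inr true
  have hl1 : ∀ x i, l x = Sum.inl i → f x = Sum.inl (a i) := by
    intro x i hx
    simp only [l] at hx
    split_ifs at hx with h1 h2
    rw [← Sum.inl_injective hx]
    exact h1.choose_spec
  have hl2 : ∀ x s, l x = Sum.inr s → ¬ ∃ i, f x = Sum.inl (a i) := by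
    intro x s hx h1
    simp only [l, dif_pos h1] at hx
    cases hx
  have hl3 : ∀ x, l x = Sum.inr false → ∃ v, f x = Sum.inl v := by
    intro x hx
    simp only [l, dif_neg (hl2 x _ hx)] at hx
    split_ifs at hx with h2
    · exact Sum.isLeft_iff.1 h2
    · cases hx
  have hl4 : ∀ x, l x = Sum.inr true → ∃ w, f x = Sum.inr w := by
    intro x hx
    simp only [l, dif_neg (hl2 x _ hx)] at hx
    split_ifs at hx with h2
    · cases hx
    · exact Sum.isRight_iff.1 (by simpa using h2)
  have h₁ : ∀ x : side l false, ∃ v, Sum.inl v = f x := by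
    rintro ⟨x, hx⟩
    rcases hlx : l x with i | s
    · exact ⟨a i, (hl1 x i hlx).symm⟩
    · cases s
      · exact (hl3 x hlx).imp fun _ => Eq.symm
      · exact absurd hlx hx
  have h₂ : ∀ x : side l true, ∃ w, glue a b w = f x := by
    rintro ⟨x, hx⟩
    rcases hlx : l x with i | s
    · exact ⟨b i, by rw [hd.glue_apply, hl1 x i hlx]⟩
    · cases s
      · exact absurd hlx hx
      · obtain ⟨⟨w, hw⟩, hfx⟩ := hl4 x hlx
        exact ⟨w, (dif_neg fun h => hw h : _ = _).trans hfx.symm⟩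
  choose h₁ hh₁ using h₁
  choose h₂ hh₂ using h₂
  refine ⟨l, h₁, h₂, ⟨fun x y hxy he => ?_, fun x y hxy => ?_, fun x i hx => ?_, fun x i hx he => ?_⟩,
    ⟨fun x y hxy he => ?_, fun x y hxy => ?_, fun x i hx => ?_, fun x i hx he => ?_⟩, ?_⟩
  · exact hxy (Subtype.ext (hfi (by rw [← hh₁, ← hh₁, he])))
  · rw [← hd.adj_inl_iff, hh₁, hh₁]
    exact hf _ _ hxy
  · exact Sum.inl_injective ((hh₁ x).trans (hl1 x i hx))
  · exact hl2 x _ hx ⟨i, by rw [← hh₁, he]⟩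
  · exact hxy (Subtype.ext (hfi (by rw [← hh₂, ← hh₂, he])))
  · rw [← hd.adj_glue_iff, hh₂, hh₂]
    exact hf _ _ hxy
  · exact hd.glue_injective ((hh₂ x).trans ((hl1 x i hx).trans (hd.glue_apply i).symm))
  · exact hl2 x _ hx ⟨i, by rw [← hh₂, he, hd.glue_apply]⟩
  · intro x y hxy hx hy
    obtain ⟨w, hw⟩ := hl4 x hx
    obtain ⟨v, hv⟩ := hl3 y hy
    have := hf x y hxy
    rw [freeAmalgam_adj] at this
    rcases this with ⟨-, ⟨z, z', -, hz, -⟩ | ⟨z, z', -, -, hz⟩⟩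
    · rw [hw] at hz
      cases hz
    · rw [hv] at hz
      obtain ⟨i, -, rfl⟩ := hd.glue_eq_inl.1 hz
      exact hl2 y _ hy ⟨i, hv⟩

/-- The two parts agree on the marked vertices and have disjoint private images, so they glue to an
injective map; it preserves edges, since no edge joins the private parts. -/
lemma isContained_of_realizes {F : SimpleGraph X} {l : X → ι ⊕ Bool} {h₁ : side l false → V}
    {h₂ : side l true → V} (hr₁ : Realizes F l false G a h₁) (hr₂ : Realizes F l true G a h₂)
    (hdisj : ∀ (x : side l false) (y : side l true), l x = Sum.inr false → l y = Sum.inr true → h₁ x ≠ h₂ y)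
    (hF : ∀ x y, F.Adj x y → l x = Sum.inr true → l y ≠ Sum.inr false) : F.IsContained G := by
  classical
  have hs : ∀ x, l x = Sum.inr true → l x ≠ Sum.inr (!true) := fun x hx h => by
    rw [hx] at h; cases h
  let f : X → V := fun x => if hx : l x = Sum.inr true then h₂ ⟨x, hs x hx⟩ else h₁ ⟨x, hx⟩
  have hf1 : ∀ x (hx : l x ≠ Sum.inr true), f x = h₁ ⟨x, hx⟩ := fun x hx => dif_neg hx
  have hf2 : ∀ x (hx : l x ≠ Sum.inr (!true)), (l x = Sum.inr true ∨ ∃ i, l x = Sum.inl i) →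
      f x = h₂ ⟨x, hx⟩ := by
    rintro x hx (h | ⟨i, h⟩)
    · exact dif_pos h
    · have hne : l x ≠ Sum.inr true := fun h' => by rw [h] at h'; cases h'
      rw [hf1 x hne, hr₁.2.2.1 _ i h, hr₂.2.2.1 _ i h]
  have hcases : ∀ x, l x = Sum.inr true ∨ l x = Sum.inr false ∨ ∃ i, l x = Sum.inl i := by
    intro x
    rcases l x with i | _ | _ <;> simp
  have hmix : ∀ x y, l x = Sum.inr true → l y ≠ Sum.inr true → f x ≠ f y := by
    intro x y hx hy
    rw [hf2 x (hs x hx) (Or.inl hx), hf1 y hy]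
    rcases hcases y with h | h | ⟨i, h⟩
    · exact absurd h hy
    · exact (hdisj ⟨y, hy⟩ ⟨x, hs x hx⟩ h hx).symm
    · rw [hr₁.2.2.1 _ i h]
      exact hr₂.2.2.2 ⟨x, hs x hx⟩ i hx
  have hadj : ∀ x y, F.Adj x y → l x = Sum.inr true → G.Adj (f x) (f y) := by
    intro x y hxy hx
    have hy := hF x y hxy hx
    rw [hf2 x (hs x hx) (Or.inl hx), hf2 y hy ?_]
    · exact hr₂.2.1 ⟨x, _⟩ ⟨y, _⟩ hxy
    · rcases hcases y with h | h | h
      exacts [Or.inl h, absurd h hy, Or.inr h]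
  refine isContained_of_injective f (fun x y he => ?_) fun x y hxy => ?_
  · by_contra hne
    by_cases hx : l x = Sum.inr true <;> by_cases hy : l y = Sum.inr true
    · rw [hf2 x (hs x hx) (Or.inl hx), hf2 y (hs y hy) (Or.inl hy)] at he
      exact hr₂.1 _ _ (fun h => hne (congrArg Subtype.val h)) he
    · exact hmix x y hx hy he
    · exact hmix y x hy hx he.symm
    · rw [hf1 x hx, hf1 y hy] at he
      exact hr₁.1 _ _ (fun h => hne (congrArg Subtype.val h)) he
  · by_cases hx : l x = Sum.inr true
    · exact hadj x y hxy hx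
    by_cases hy : l y = Sum.inr true
    · exact (hadj y x hxy.symm hy).symm
    rw [hf1 x hx, hf1 y hy]
    exact hr₁.2.1 ⟨x, _⟩ ⟨y, _⟩ hxy

/-- The part `true` of the labelled graph `F` is found in `G` over the tuple `a`. -/
def HasPart (F : SimpleGraph X) (l : X → ι ⊕ Bool) (G : SimpleGraph V) (a : ι → V) : Prop :=
  ∃ h, Realizes F l true G a h

/-- The part `true` of the labelled graph `F` is found in `G` over the tuple `a`, away from any
given image of the part `false`. -/
def AvoidsPart (F : SimpleGraph X) (l : X → ι ⊕ Bool) (G : SimpleGraph V) (a : ι → V) : Prop :=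
  ∀ z : side l false → V, ∃ h, Realizes F l true G a h ∧
    ∀ (x : side l true) y, l x = Sum.inr true → h x ≠ z y

/-- The part lying in `H` is replaced by one in `G`, disjoint from the part already there, which
gives a forbidden copy inside `G`. -/
lemma omits_freeAmalgam {C : Set FiniteGraph} (hG : Omits C G) (hd : SameDiag G a H b)
    (h : ∀ F ∈ C, ∀ l, HasPart F.2 l H b → AvoidsPart F.2 l G a) :
    Omits C (freeAmalgam G a H b) := by
  rintro F hF hc
  obtain ⟨l, h₁, h₂, hr₁, hr₂, hx⟩ := exists_realizes_of_isContained hd hc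
  obtain ⟨h₃, hr₃, hd₃⟩ := h F hF l ⟨h₂, hr₂⟩ h₁
  exact hG F hF (isContained_of_realizes hr₁ hr₃ (fun x y _ hy => (hd₃ y x hy).symm) hx)

/-- Two tuples of existentially complete graphs whose free amalgam is `C`-free have the same
existential type. -/
lemma loc_of_omits_freeAmalgam {C : Set FiniteGraph} {V W : Type} {G : SimpleGraph V}
    {H : SimpleGraph W} {n : ℕ} {a : Fin n → V} {b : Fin n → W}
    (hG : IsCountableFree C G) (hH : IsExistentiallyComplete C H)
    (hd : SameDiag G a H b) (h : Omits C (freeAmalgam G a H b)) : Loc G a H b := by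
  have := hG.1
  have := hH.1.1
  have h1 := loc_of_embedding hd.inlEmbedding a
  rw [hd.inl_comp_eq] at h1
  exact h1.trans (hH.loc hd.glueEmbedding ⟨inferInstance, h⟩ b)

section Formulas

variable [Finite X] [Finite ι] {γ : Type*}

/-- The formula saying that the variables `u` realize the part `true` of `F` over the
variables `t`. -/
noncomputable def realizesF (F : SimpleGraph X) (l : X → ι ⊕ Bool) (t : ι → γ)
    (u : side l true → γ) : Language.graph.Formula γ :=
  (Formula.iInf fun p : side l true × side l true =>
    guardF (p.1 ≠ p.2) (eqF (u p.1) (u p.2)).not ⊓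
      guardF (F.Adj p.1 p.2) (adjF (u p.1) (u p.2))) ⊓
  Formula.iInf fun p : side l true × ι =>
    guardF (l p.1 = Sum.inl p.2) (eqF (u p.1) (t p.2)) ⊓
      guardF (l p.1 = Sum.inr true) (eqF (u p.1) (t p.2)).not

lemma holds_realizesF {F : SimpleGraph X} {l : X → ι ⊕ Bool} {t : ι → γ} {u : side l true → γ}
    {v : γ → V} : Holds G (realizesF F l t u) v ↔ Realizes F l true G (v ∘ t) (v ∘ u) := by
  simp only [realizesF, holds_inf, holds_iInf, holds_guardF, holds_not, holds_eqF, holds_adjF,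
    Realizes, Prod.forall, forall_and, and_assoc, Function.comp]

/-- The formula expressing `HasPart`. -/
noncomputable def hasPartF (F : SimpleGraph X) (l : X → ι ⊕ Bool) : Language.graph.Formula ι :=
  Formula.iExs (side l true) (realizesF F l Sum.inl Sum.inr)

lemma holds_hasPartF {F : SimpleGraph X} {l : X → ι ⊕ Bool} :
    Holds G (hasPartF F l) a ↔ HasPart F l G a := by
  simp only [hasPartF, holds_iExs, holds_realizesF, HasPart]
  rfl

/-- The formula expressing `AvoidsPart`. -/
noncomputable def avoidsPartF (F : SimpleGraph X) (l : X → ι ⊕ Bool) : Language.graph.Formula ι :=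
  Formula.iAlls (side l false) <| Formula.iExs (side l true) <|
    realizesF F l (Sum.inl ∘ Sum.inl) Sum.inr ⊓
      Formula.iInf fun p : side l true × side l false =>
        guardF (l p.1 = Sum.inr true) (eqF (Sum.inr p.1) (Sum.inl (Sum.inr p.2))).not

lemma holds_avoidsPartF {F : SimpleGraph X} {l : X → ι ⊕ Bool} :
    Holds G (avoidsPartF F l) a ↔ AvoidsPart F l G a := by
  simp only [avoidsPartF, holds_iAlls, holds_iExs, holds_inf, holds_iInf, holds_realizesF,
    holds_guardF, holds_not, holds_eqF, AvoidsPart, Prod.forall]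
  rfl

end Formulas

end FreeAmalgam

/-! ### Models of `TStar C`, Löwenheim–Skolem and limits. -/

section Elementary

variable {C : Set FiniteGraph}

lemma holds_relabel {α β V : Type*} {G : SimpleGraph V} {φ : Language.graph.Formula α} {g : α → β}
    {v : β → V} : Holds G (φ.relabel g) v ↔ Holds G φ (v ∘ g) := by
  let := G.structure
  exact Formula.realize_relabel

lemma satSentence_iff {V : Type*} {G : SimpleGraph V} {φ : Language.graph.Sentence} :
    SatSentence G φ ↔ Holds G φ default := Iff.rfl

/-- With no marked places and all of `F` labelled `true`, `hasPartF` is the sentence asserting a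
copy of `F`. -/
lemma omits_of_model {V : Type} {G : SimpleGraph V} (hG : ∀ σ ∈ TStar C, SatSentence G σ) :
    Omits C G := by
  rintro F hF hc
  let l : Fin F.1 → Empty ⊕ Bool := fun _ => Sum.inr true
  have hl : ∀ x, l x ≠ Sum.inr (!true) := fun x h => by cases h
  refine holds_not.1 (hG (hasPartF F.2 l).not fun W H hH => holds_not.2 fun h => ?_)
    (holds_hasPartF.2 ?_)
  · obtain ⟨h, hr⟩ := holds_hasPartF.1 h
    exact hH.1.2 F hF (isContained_of_injective (fun x => h ⟨x, hl x⟩)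
      (fun x y hxy => by_contra fun hne => hr.1 _ _ (fun h => hne (congrArg Subtype.val h)) hxy)
      fun x y hxy => hr.2.1 ⟨x, _⟩ ⟨y, _⟩ hxy)
  · obtain ⟨h, hi, hh⟩ := exists_injective_of_isContained hc
    exact ⟨fun x => h x, fun x y hne he => hne (Subtype.ext (hi he)), fun x y hxy => hh _ _ hxy,
      fun x i => i.elim, fun x i => i.elim⟩

/-- The formula saying that a tuple looks like `c` from the point of view of the parts of the
members of `C`. -/
noncomputable def lookF (C : Set FiniteGraph) [Finite C] {V : Type} (G : SimpleGraph V) {k : ℕ}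
    (c : Fin k → V) : Language.graph.Formula (Fin k) :=
  diagF G c id ⊓ Formula.iInf fun p : Σ F : C, (Fin F.1.1 → Fin k ⊕ Bool) =>
    litF (HasPart p.1.1.2 p.2 G c) (hasPartF p.1.1.2 p.2)

lemma holds_lookF [Finite C] {V W : Type} {G : SimpleGraph V} {k : ℕ} {c : Fin k → V}
    {H : SimpleGraph W} {d : Fin k → W} : Holds H (lookF C G c) d ↔
      SameDiag G c H d ∧ ∀ F ∈ C, ∀ l, HasPart F.2 l G c ↔ HasPart F.2 l H d := by
  simp only [lookF, holds_inf, holds_diagF, holds_iInf, holds_litF, holds_hasPartF, Sigma.forall,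
    Subtype.forall, SameDiag, id]

/-- The finite piece of `K` on `T` and `f ∘ c` is glued freely to `H` over `d`. The result is
`C`-free, so existential completeness of `H` brings the piece into `H`. -/
lemma loc_of_look (hconn : ∀ F ∈ C, F.2.Connected) {V Y W : Type} {G : SimpleGraph V}
    {K : SimpleGraph Y} (f : G ↪g K) (hK : IsCountableFree C K) {k : ℕ} {c : Fin k → V}
    {T : Set Y} (hT : T.Finite) (hc : ∀ v, f v ∈ T → v ∈ Set.range c)
    {H : SimpleGraph W} (hH : IsExistentiallyComplete C H) {d : Fin k → W}
    (hd : SameDiag G c H d) (hl : ∀ F ∈ C, ∀ l, HasPart F.2 l H d → HasPart F.2 l G c) :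
    ∃ e : Y → W, EmbOn K H (T ∪ Set.range (f ∘ c)) e ∧ ∀ i, e (f (c i)) = d i := by
  classical
  have := hK.1
  set T' := T ∪ Set.range (f ∘ c) with hT'
  have hT'fin : T'.Finite := hT.union (Set.finite_range _)
  let B := K.induce T'
  let b : Fin k → T' := fun i => ⟨f (c i), Or.inr ⟨i, rfl⟩⟩
  let ib : B ↪g K := SimpleGraph.Embedding.induce T'
  have hB : IsCountableFree C B := ⟨inferInstance, hK.2.of_embedding ib⟩
  have hdB : SameDiag B b H d := fun i j => by
    refine ⟨Iff.trans ?_ (hd i j).1, Iff.trans ?_ (hd i j).2⟩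
    · exact Subtype.ext_iff.trans f.injective.eq_iff
    · exact f.map_adj_iff
  have hom : Omits C (freeAmalgam B b H d) := by
    rintro F hF hcon
    obtain ⟨l, h₁, h₂, hr₁, hr₂, hx⟩ := exists_realizes_of_isContained hdB hcon
    -- The part in `H` is found in `G`, hence in `K`. Its private vertices avoid the finite piece,
    -- whose only points from `G` are those of `c`; so a forbidden copy would arise in `K`.
    obtain ⟨h₃, hr₃⟩ := hl F hF l ⟨h₂, hr₂⟩
    refine hK.2 F hF (isContained_of_realizes (hr₁.map ib) (hr₃.map f) (fun x y hx hy he => ?_) hx)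
    have hmem : f (h₃ y) ∈ T' := by
      rw [show f (h₃ y) = ib (h₁ x) from he.symm]
      exact (h₁ x).2
    have hr : ∃ i, h₃ y = c i := by
      rcases hmem with h | ⟨i, hi⟩
      · exact (hc _ h).imp fun _ => Eq.symm
      · exact ⟨i, f.injective hi.symm⟩
    obtain ⟨i, hi⟩ := hr
    exact hr₃.2.2.2 y i hy hi
  obtain ⟨e, he, heb⟩ := loc_of_omits_freeAmalgam hB hH hdB hom Set.univ
    (@Set.finite_univ _ hT'fin.to_subtype)
  by_cases hY : IsEmpty Y
  · exact ⟨isEmptyElim, fun x => isEmptyElim x, fun i => isEmptyElim (f (c i))⟩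
  have hW : Nonempty W := hH.nonempty hconn fun F hF h1 => hY (isEmpty_of_omits hK.2 ⟨F, hF, h1⟩)
  refine ⟨fun y => if h : y ∈ T' then e ⟨y, h⟩ else hW.some, fun x hx y hy => ?_, fun i => ?_⟩
  · simp only [dif_pos hx, dif_pos hy]
    exact ⟨fun h => congrArg Subtype.val ((he _ trivial _ trivial).1 h), (he _ trivial _ trivial).2⟩
  · simp only [dif_pos (show f (c i) ∈ T' from Or.inr ⟨i, rfl⟩)]
    exact heb i

/-- Countable models of `T*` are existentially complete. -/
lemma isExistentiallyComplete_of_model (hfin : C.Finite) (hconn : ∀ F ∈ C, F.2.Connected)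
    {V : Type} [Countable V] {G : SimpleGraph V} (hG : ∀ σ ∈ TStar C, SatSentence G σ) :
    IsExistentiallyComplete C G := by
  have := hfin.to_subtype
  refine isExistentiallyComplete_of_loc ⟨inferInstance, omits_of_model hG⟩
    fun Y K f hK n a S hS => ?_
  by_cases hY : IsEmpty Y
  · exact ⟨isEmptyElim, fun x => isEmptyElim x, fun i => isEmptyElim (f (a i))⟩
  obtain ⟨y⟩ := not_isEmpty_iff.1 hY
  -- The extra point makes the diagram assert nonemptiness even when `S` is empty.
  have hT : (insert y S).Finite := hS.insert y
  have := hT.to_subtype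
  obtain ⟨k, c, -, hc⟩ := ((hT.preimage f.injective.injOn).union (Set.finite_range a)).fin_param
  -- True in all existentially complete graphs by `loc_of_look`, hence in `G`, where it is applied
  -- to `c` itself.
  let σ : Language.graph.Sentence := Formula.iAlls (Fin k)
    (((lookF C G c).imp (embF K (f ∘ c) (insert y S))).relabel Sum.inr)
  have hσ : σ ∈ TStar C := by
    intro W H hH
    rw [satSentence_iff, holds_iAlls]
    intro d
    rw [holds_relabel, holds_imp, Sum.elim_comp_inr, holds_lookF]
    rintro ⟨hd, hl⟩
    rw [holds_embF fun hne => hH.nonempty hconn fun F hF h1 =>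
      hY (isEmpty_of_omits hK.2 ⟨F, hF, h1⟩)]
    exact loc_of_look hconn f hK hT (fun v hv => hc ▸ Or.inl hv) hH hd fun F hF l => (hl F hF l).2
  have h1 := hG σ hσ
  rw [satSentence_iff, holds_iAlls] at h1
  have h2 := h1 c
  rw [holds_relabel, holds_imp, Sum.elim_comp_inr, holds_lookF] at h2
  have h3 := h2 ⟨fun i j => ⟨Iff.rfl, Iff.rfl⟩, fun _ _ _ => Iff.rfl⟩
  have hne := nonempty_of_holds_embF (Set.insert_nonempty y S) h3
  obtain ⟨e, he, hec⟩ := (holds_embF fun _ => hne).1 h3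
  refine ⟨e, he.mono ((Set.subset_insert y S).trans Set.subset_union_left), fun i => ?_⟩
  obtain ⟨j, hj⟩ : a i ∈ Set.range c := hc ▸ Or.inr ⟨i, rfl⟩
  simp only [Function.comp, ← hj]
  exact hec j

lemma model_simpleGraph_of_model {M : Type*} [Language.graph.Structure M] (hM : M ⊨ TStar C) :
    M ⊨ Theory.simpleGraph :=
  hM.mono fun σ hσ V G _ => by
    let := G.structure
    exact (simpleGraph_model G).realize_of_mem σ hσ

lemma exists_graph_of_model (hfin : C.Finite) (hconn : ∀ F ∈ C, F.2.Connected) {N : Type}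
    [Countable N] [inst : Language.graph.Structure N] (hN : N ⊨ TStar C) :
    ∃ G : SimpleGraph N, G.structure = inst ∧ IsExistentiallyComplete C G := by
  have := model_simpleGraph_of_model hN
  refine ⟨simpleGraphOfStructure N, structure_simpleGraphOfStructure,
    isExistentiallyComplete_of_model hfin hconn fun σ hσ => ?_⟩
  rw [SatSentence, structure_simpleGraphOfStructure]
  exact hN.realize_of_mem σ hσ

lemma IsExistentiallyComplete.model {V : Type} {G : SimpleGraph V}
    (hG : IsExistentiallyComplete C G) : @Theory.Model _ V G.structure (TStar C) := by
  let := G.structure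
  exact ⟨fun σ hσ => hσ V G hG⟩

lemma countable_symbols : Language.graph.card ≤ Cardinal.aleph0 := by
  have h1 : ∀ n, Countable (Language.graph.Functions n) := fun n =>
    inferInstanceAs (Countable Empty)
  have h2 : ∀ n, Countable (Language.graph.Relations n) := fun n => inferInstance
  exact Cardinal.mk_le_aleph0_iff.2 (inferInstanceAs
    (Countable ((Σ n, Language.graph.Functions n) ⊕ Σ n, Language.graph.Relations n)))

lemma exists_countable_elementarySubstructure {M : Type*} [Language.graph.Structure M] {s : Set M}
    (hs : s.Countable) :
    ∃ S : Language.graph.ElementarySubstructure M, s ⊆ S ∧ Countable S := by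
  by_cases hM : Countable M
  · exact ⟨⊤, fun _ _ => trivial, Subtype.countable⟩
  · have hcard : Cardinal.aleph0 ≤ Cardinal.mk M := by
      rw [← not_lt]
      exact fun h => hM (Cardinal.mk_le_aleph0_iff.1 h.le)
    obtain ⟨S, hS, hc⟩ := exists_elementarySubstructure_card_eq Language.graph s
      Cardinal.aleph0.{0} le_rfl (by simpa using hs) (by simpa using countable_symbols) (by simpa using hcard)
    refine ⟨S, hS, Cardinal.mk_le_aleph0_iff.1 ?_⟩
    simpa using hc.le

/-- Downward Löwenheim–Skolem, with an existentially complete graph as elementary submodel. -/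
lemma exists_elementary_subgraph (hfin : C.Finite) (hconn : ∀ F ∈ C, F.2.Connected) {M : Type*}
    [Language.graph.Structure M] (hM : M ⊨ TStar C) {s : Set M} (hs : s.Countable) :
    ∃ (N : Type) (G : SimpleGraph N) (j : N → M), IsExistentiallyComplete C G ∧ s ⊆ Set.range j ∧
      ∀ {α : Type} (φ : Language.graph.Formula α) (v : α → N),
        Holds G φ v ↔ φ.Realize (j ∘ v) := by
  obtain ⟨S, hsS, hS⟩ := exists_countable_elementarySubstructure hs
  have : Small.{0} S := Countable.toSmall S
  let ε : S ≃ Shrink.{0} S := equivShrink.{0} S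
  let inst : Language.graph.Structure (Shrink.{0} S) := ε.inducedStructure
  let ε' : S ≃[Language.graph] Shrink.{0} S := ε.inducedStructureEquiv
  have : Countable (Shrink.{0} S) := ε.symm.injective.countable
  have hSm : S ⊨ TStar C := inferInstance
  have hN : Shrink.{0} S ⊨ TStar C := StrongHomClass.theory_model ε'
  obtain ⟨G, hG, hGe⟩ := exists_graph_of_model hfin hconn hN
  refine ⟨Shrink.{0} S, G, fun x => ε'.symm x, hGe, fun x hx => ⟨ε ⟨x, hsS hx⟩, ?_⟩, fun φ v => ?_⟩
  · exact congrArg Subtype.val (ε'.symm_apply_apply ⟨x, hsS hx⟩)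
  · rw [Holds, hG, ← StrongHomClass.realize_formula ε'.symm φ]
    exact (S.subtype.map_formula φ _).symm

/-- A sequence of tuples in existentially complete graphs has a limit, in an existentially complete
graph elementarily embedded in an ultraproduct. -/
lemma exists_limit (hfin : C.Finite) (hconn : ∀ F ∈ C, F.2.Connected) (hC : ∀ F ∈ C, F.1 ≠ 1)
    {V : ℕ → Type} {G : ∀ i, SimpleGraph (V i)} (hG : ∀ i, IsExistentiallyComplete C (G i)) {n : ℕ}
    (a : ∀ i, Fin n → V i) :
    ∃ (N : Type) (K : SimpleGraph N) (lift : N → ∀ i, V i) (c : Fin n → N),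
      IsExistentiallyComplete C K ∧
      (∀ l, ∀ᶠ i in Filter.hyperfilter ℕ, lift (c l) i = a i l) ∧
      ∀ {α : Type} (φ : Language.graph.Formula α) (v : α → N),
        Holds K φ v ↔ ∀ᶠ i in Filter.hyperfilter ℕ, Holds (G i) φ fun x => lift (v x) i := by
  let inst : ∀ i, Language.graph.Structure (V i) := fun i => (G i).structure
  have hne : ∀ i, Nonempty (V i) := fun i => (hG i).nonempty hconn hC
  let U := Filter.hyperfilter ℕ
  have hM : (U : Filter ℕ).Product V ⊨ TStar C := ⟨fun σ hσ =>
    (Ultraproduct.sentence_realize σ).2 (Filter.Eventually.of_forall fun i => hσ (V i) (G i) (hG i))⟩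
  let a' : Fin n → (U : Filter ℕ).Product V := fun l => ((fun i => a i l : ∀ i, V i) : _)
  obtain ⟨N, K, j, hK, hs, hj⟩ := exists_elementary_subgraph hfin hconn hM
    (Set.countable_range a')
  choose lift hlift using fun x => Quotient.exists_rep (j x)
  choose c hc using fun l => hs ⟨l, rfl⟩
  refine ⟨N, K, lift, c, hK, fun l => ?_, fun φ v => ?_⟩
  · exact Quotient.exact ((hlift (c l)).trans (hc l))
  · rw [hj, show j ∘ v = fun x => ((lift (v x) : ∀ i, V i) : (U : Filter ℕ).Product V) from
      funext fun x => (hlift (v x)).symm]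
    exact Ultraproduct.realize_formula_cast φ fun x => lift (v x)

end Elementary

/-! ### Algebraic closure through finite embeddings. -/

section AlgebraicClosure

/-- The images of `b` under the embeddings of the finite part `S` that fix `A` pointwise. -/
def images {V : Type*} (G : SimpleGraph V) (A S : Set V) (b : V) : Set V :=
  {y | ∃ e : V → V, EmbOn G G S e ∧ (∀ x ∈ A, e x = x) ∧ e b = y}

/-- The points which have finitely many images over `A` under the embeddings of some finite part
of the graph. -/
def aclSet {V : Type*} (G : SimpleGraph V) (A : Set V) : Set V :=
  {b | ∃ S : Set V, S.Finite ∧ A ⊆ S ∧ b ∈ S ∧ (images G A S b).Finite}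

variable {V : Type*} {G : SimpleGraph V} {A : Set V}

lemma subset_aclSet (hA : A.Finite) : A ⊆ aclSet G A := fun b hb =>
  ⟨A, hA, subset_rfl, hb, (Set.finite_singleton b).subset fun _ ⟨_, _, heA, heb⟩ =>
    heb.symm.trans (heA b hb)⟩

lemma exists_embOn_notMem (hA : aclSet G A ⊆ A) {Z : Set V} (hZ : Z.Finite) {t : V} (ht : t ∉ A)
    {S : Set V} (hS : S.Finite) (hAS : A ⊆ S) (htS : t ∈ S) :
    ∃ e : V → V, EmbOn G G S e ∧ (∀ x ∈ A, e x = x) ∧ e t ∉ Z := by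
  have hinf : (images G A S t).Infinite := fun hf => ht (hA ⟨S, hS, hAS, htS, hf⟩)
  obtain ⟨y, ⟨e, he, heA, rfl⟩, hy⟩ := hinf.exists_notMem_finite hZ
  exact ⟨e, he, heA, hy⟩

/-- Over an algebraically closed set, the points outside of it can be moved off any finite set. -/
lemma exists_embOn_avoiding (hA : aclSet G A ⊆ A) {S : Set V} (hS : S.Finite) (hAS : A ⊆ S)
    (T : Finset V) : ∀ Z : Set V, Z.Finite → (∀ t ∈ T, t ∉ A) → (T : Set V) ⊆ S →
      ∃ e : V → V, EmbOn G G S e ∧ (∀ x ∈ A, e x = x) ∧ ∀ t ∈ T, e t ∉ Z := by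
  classical
  induction T using Finset.induction_on with
  | empty => exact fun Z _ _ _ => ⟨id, embOn_id S, fun _ _ => rfl, by simp⟩
  | insert t T htT ih =>
    intro Z hZ hTA hTS
    have hTA' : ∀ t ∈ T, t ∉ A := fun x hx => hTA x (Finset.mem_insert_of_mem hx)
    have hTS' : (T : Set V) ⊆ S := fun x hx => hTS (Finset.mem_insert_of_mem hx)
    have htA : t ∉ A := hTA t (Finset.mem_insert_self _ _)
    have htS : t ∈ S := hTS (Finset.mem_insert_self _ _)
    -- By induction there are infinitely many embeddings moving `T` off `Z`, with pairwise disjoint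
    -- images of `T`; only the image of `t` is not controlled.
    obtain ⟨e, he, hdisj⟩ := exists_seq_of_forall_finset_exists
      (fun e : V → V => EmbOn G G S e ∧ (∀ x ∈ A, e x = x) ∧ ∀ x ∈ T, e x ∉ Z)
      (fun e e' => ∀ x ∈ T, ∀ x' ∈ T, e x ≠ e' x') (fun s _ => by
        obtain ⟨e, he, heA, heT⟩ := ih (Z ∪ ⋃ f ∈ s, f '' T)
          (hZ.union (s.finite_toSet.biUnion fun f _ => T.finite_toSet.image f)) hTA' hTS'
        refine ⟨e, ⟨he, heA, fun x hx hxZ => heT x hx (Or.inl hxZ)⟩, fun f hf x hx x' hx' h => ?_⟩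
        exact heT x' hx' (Or.inr (Set.mem_biUnion hf ⟨x, hx, h⟩)))
    by_cases hgood : ∃ i, e i t ∉ Z
    · obtain ⟨i, hi⟩ := hgood
      refine ⟨e i, (he i).1, (he i).2.1, fun x hx => ?_⟩
      rcases Finset.mem_insert.1 hx with rfl | hx
      exacts [hi, (he i).2.2 x hx]
    push Not at hgood
    have := hZ.to_subtype
    -- If every `e i` sends `t` into `Z`, infinitely many send it to one point `s`, and `|Z| + 1` of
    -- them are kept.
    obtain ⟨⟨s, hs⟩, hinf⟩ := Finite.exists_infinite_fiber fun i : ℕ => (⟨e i t, hgood i⟩ : Z)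
    obtain ⟨I, hI, hIcard⟩ := (Set.infinite_coe_iff.1 hinf).exists_subset_card_eq
      (hZ.toFinset.card + 1)
    have hIs : ∀ i ∈ I, e i t = s := fun i hi => congrArg Subtype.val (hI hi)
    obtain ⟨i₀, hi₀⟩ : I.Nonempty := Finset.card_pos.1 (by omega)
    have hsA : s ∉ A := fun h => htA <| by
      have h1 : e i₀ s = e i₀ t := by rw [(he i₀).2.1 s h, hIs i₀ hi₀]
      exact (he i₀).1.injOn (hAS h) htS h1 ▸ h
    let S' : Set V := A ∪ ⋃ i ∈ I, e i '' S
    have hS' : S'.Finite := (hS.subset hAS).union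
      (I.finite_toSet.biUnion fun i _ => hS.image (e i))
    have hmem : ∀ i ∈ I, ∀ x ∈ S, e i x ∈ S' := fun i hi x hx =>
      Or.inr (Set.mem_biUnion hi ⟨x, hx, rfl⟩)
    -- A single `f` moves `s` off `Z`. If each `f ∘ e i` still hit `Z`, it would be at a point of
    -- `T`; these hits are distinct by disjointness, too many for `Z`.
    obtain ⟨f, hf, hfA, hfs⟩ := exists_embOn_notMem hA hZ hsA hS' Set.subset_union_left
      (hIs i₀ hi₀ ▸ hmem i₀ hi₀ t htS)
    by_contra hbad
    push Not at hbad
    have hex : ∀ i ∈ I, ∃ x ∈ T, f (e i x) ∈ Z := fun i hi => by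
      obtain ⟨x, hx, hxZ⟩ := hbad (f ∘ e i) (hf.comp (he i).1 (hmem i hi)) fun x hx => by
        rw [Function.comp, (he i).2.1 x hx, hfA x hx]
      rcases Finset.mem_insert.1 hx with rfl | hx
      · rw [Function.comp, hIs i hi] at hxZ
        exact absurd hxZ hfs
      · exact ⟨x, hx, hxZ⟩
    have : Nonempty V := ⟨t⟩
    choose! x hxT hxZ using hex
    obtain ⟨i, hi, j, hj, hij, hfe⟩ := Finset.exists_ne_map_eq_of_card_lt_of_maps_to
      (s := I) (t := hZ.toFinset) (f := fun i => f (e i (x i))) (by omega)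
      (fun i hi => by simpa using hxZ i hi)
    have heq := hf.injOn (hmem i hi _ (hTS' (hxT i hi))) (hmem j hj _ (hTS' (hxT j hj))) hfe
    rcases lt_or_gt_of_ne hij with h | h
    · exact hdisj i j h _ (hxT i hi) _ (hxT j hj) heq
    · exact hdisj j i h _ (hxT j hj) _ (hxT i hi) heq.symm

lemma map_mem_aclSet {S : Set V} (hS : S.Finite) (hAS : A ⊆ S) {b : V} (hb : b ∈ S)
    (hfin : (images G A S b).Finite) {e : V → V} (he : EmbOn G G S e) (heA : ∀ x ∈ A, e x = x) :
    e b ∈ aclSet G A := by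
  refine ⟨e '' S, hS.image e, fun x hx => ⟨x, hAS hx, heA x hx⟩, ⟨b, hb, rfl⟩, hfin.subset ?_⟩
  rintro y ⟨f, hf, hfA, rfl⟩
  exact ⟨f ∘ e, hf.comp he fun x hx => ⟨x, hx, rfl⟩, fun x hx => by
    rw [Function.comp, heA x hx, hfA x hx], rfl⟩

/-- A local embedding from `d` back to `c` carries any finite set of such images injectively into
the images over `c`. -/
lemma finite_images_of_loc {S : Set V} (hS : S.Finite) {b : V} (hb : b ∈ S) {k : ℕ}
    {c d : Fin k → V} (hloc : Loc G d G c) (hfin : (images G (Set.range c) S b).Finite) :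
    {y | ∃ e : V → V, EmbOn G G S e ∧ (∀ i, e (c i) = d i) ∧ e b = y}.Finite := by
  classical
  by_contra hinf
  obtain ⟨J, hJ, hJcard⟩ := Set.Infinite.exists_subset_card_eq hinf (hfin.toFinset.card + 1)
  have hJ' : ∀ y ∈ J, ∃ e : V → V, EmbOn G G S e ∧ (∀ i, e (c i) = d i) ∧ e b = y :=
    fun y hy => hJ hy
  choose! e he hec heb using hJ'
  have hmem : ∀ y ∈ J, ∀ x ∈ S, e y x ∈ ⋃ y ∈ J, e y '' S := fun y hy x hx =>
    Set.mem_biUnion (show y ∈ (J : Set V) from hy) ⟨x, hx, rfl⟩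
  obtain ⟨f, hf, hfd⟩ := hloc (⋃ y ∈ J, e y '' S)
    (J.finite_toSet.biUnion fun y _ => hS.image (e y))
  obtain ⟨y, hy, y', hy', hne, heq⟩ := Finset.exists_ne_map_eq_of_card_lt_of_maps_to
    (s := J) (t := hfin.toFinset) (f := f) (by omega) (fun y hy => by
      rw [Finset.mem_coe, Set.Finite.mem_toFinset]
      refine ⟨f ∘ e y, hf.comp (he y hy) (hmem y hy), ?_, congrArg f (heb y hy)⟩
      rintro _ ⟨i, rfl⟩
      rw [Function.comp, hec y hy, hfd])
  refine hne (hf.injOn ?_ ?_ heq)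
  · exact heb y hy ▸ hmem y hy b hb
  · exact heb y' hy' ▸ hmem y' hy' b hb

/-- In an existentially complete graph, a finite algebraic closure is algebraically closed. -/
lemma aclSet_aclSet_subset {C : Set FiniteGraph} {V : Type} {G : SimpleGraph V} {A : Set V}
    (hG : IsExistentiallyComplete C G) (hA : A.Finite) (hacl : (aclSet G A).Finite) :
    aclSet G (aclSet G A) ⊆ aclSet G A := by
  classical
  rintro b ⟨S, hS, hAS, hbS, hfin⟩
  obtain ⟨k, c, -, hc⟩ := hacl.fin_param
  have hcmem : ∀ i, c i ∈ aclSet G A := fun i => hc ▸ ⟨i, rfl⟩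
  choose R hR hAR hcR hRfin using hcmem
  -- For a tuple `d` to which `c` is not locally related, a finite `Q` rules out any embedding on
  -- `Q` sending `c` to `d`.
  have hex : ∀ d : Fin k → aclSet G A, ∃ Q : Set V, Q.Finite ∧
      ((∃ e : V → V, EmbOn G G Q e ∧ ∀ i, e (c i) = d i) → Loc G c G fun i => (d i : V)) := by
    intro d
    by_cases h : Loc G c G fun i => (d i : V)
    · exact ⟨∅, Set.finite_empty, fun _ => h⟩
    · unfold Loc at h
      push Not at h
      obtain ⟨Q, hQ, hQe⟩ := h
      refine ⟨Q, hQ, fun ⟨e, he, hec⟩ => ?_⟩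
      obtain ⟨i, hi⟩ := hQe e he
      exact absurd (hec i) hi
  choose Q hQ hQloc using hex
  have := hacl.to_subtype
  let S' : Set V := S ∪ (⋃ i, R i) ∪ ⋃ d, Q d
  have hSS' : S ⊆ S' := Set.subset_union_left.trans Set.subset_union_left
  have hRS' : ∀ i, R i ⊆ S' := fun i =>
    ((Set.subset_iUnion R i).trans Set.subset_union_right).trans Set.subset_union_left
  have hQS' : ∀ d, Q d ⊆ S' := fun d => (Set.subset_iUnion Q d).trans Set.subset_union_right
  refine ⟨S', (hS.union (Set.finite_iUnion hR)).union (Set.finite_iUnion hQ),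
    ((subset_aclSet hA).trans hAS).trans hSS', hSS' hbS, ?_⟩
  -- An embedding on `S'` fixing `A` sends `c` to one of finitely many tuples `d` in the closure.
  -- For each admissible `d`, maximality reverses `Loc`, so `b` has finitely many images.
  refine Set.Finite.subset (Set.finite_iUnion fun d : {d : Fin k → aclSet G A //
    Loc G c G fun i => (d i : V)} => finite_images_of_loc hS hbS
      (hG.loc_symm hG.1 d.2) (hc.symm ▸ hfin)) ?_
  rintro y ⟨e, he, heA, rfl⟩
  let d : Fin k → aclSet G A := fun i =>
    ⟨e (c i), map_mem_aclSet (hR i) (hAR i) (hcR i) (hRfin i) (he.mono (hRS' i)) heA⟩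
  exact Set.mem_iUnion.2 ⟨⟨d, hQloc d ⟨e, he.mono (hQS' d), fun _ => rfl⟩⟩, e, he.mono hSS',
    fun _ => rfl, rfl⟩

lemma aclSet_subset_acl (hA : A.Finite) : aclSet G A ⊆ @acl V G.structure A := by
  rintro b ⟨S, hS, hAS, hbS, hfin⟩
  obtain ⟨n, p, -, hp⟩ := hA.fin_param
  have := hS.to_subtype
  refine ⟨n, embF G (Fin.cons b p : Fin (n + 1) → V) S, p, isExistential_embF _ S,
    fun i => hp ▸ ⟨i, rfl⟩, hfin.subset fun x hx => ?_, ?_⟩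
  · obtain ⟨e, he, hep⟩ := (holds_embF id).1 hx
    refine ⟨e, he.mono Set.subset_union_left, fun y hy => ?_, hep 0⟩
    obtain ⟨i, rfl⟩ := hp.symm ▸ hy
    exact hep i.succ
  · exact (holds_embF id).2 ⟨id, embOn_id _, fun _ => rfl⟩

lemma avoidsPart_of_aclSet_subset {X : Type*} [Finite X] {k : ℕ} {c : Fin k → V}
    (hc : aclSet G (Set.range c) ⊆ Set.range c) {F : SimpleGraph X} {l : X → Fin k ⊕ Bool}
    (h : HasPart F l G c) : AvoidsPart F l G c := by
  classical
  obtain ⟨h, hr⟩ := h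
  intro z
  have hT : (h '' {x | l x = Sum.inr true}).Finite := Set.toFinite _
  obtain ⟨e, he, hec, heT⟩ := exists_embOn_avoiding (S := Set.range c ∪ Set.range h) hc
    ((Set.finite_range c).union (Set.finite_range h)) Set.subset_union_left hT.toFinset
    (Set.range z) (Set.finite_range z) (fun t ht => by
      rw [Set.Finite.mem_toFinset] at ht
      obtain ⟨x, hx, rfl⟩ := ht
      rintro ⟨i, hi⟩
      exact hr.2.2.2 x i hx hi.symm) (fun t ht => by
      rw [Set.Finite.coe_toFinset] at ht
      obtain ⟨x, -, rfl⟩ := ht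
      exact Or.inr ⟨x, rfl⟩)
  have hm : ∀ x, h x ∈ Set.range c ∪ Set.range h := fun x => Or.inr ⟨x, rfl⟩
  refine ⟨e ∘ h, ⟨fun x y hxy hxy' => hr.1 x y hxy (he.injOn (hm x) (hm y) hxy'),
    fun x y hxy => (he _ (hm x) _ (hm y)).2.2 (hr.2.1 x y hxy),
    fun x i hx => by rw [Function.comp, hr.2.2.1 x i hx, hec _ ⟨i, rfl⟩], fun x i hx hxi => ?_⟩,
    fun x y hx hxy => ?_⟩
  · refine hr.2.2.2 x i hx (he.injOn (hm x) (Or.inl ⟨i, rfl⟩) ?_)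
    rw [hec _ ⟨i, rfl⟩]
    exact hxi
  · exact heT (h x) (by rw [Set.Finite.mem_toFinset]; exact ⟨x, hx, rfl⟩) ⟨y, hxy.symm⟩

end AlgebraicClosure

/-! ### The implications between the four conditions. -/

section Categoricity

universe u

variable {C : Set FiniteGraph}

/-- An isomorphism of first-order structures between graphs as an isomorphism of graphs. -/
def isoOfEquiv {V W : Type*} {G : SimpleGraph V} {H : SimpleGraph W}
    (e : @Language.Equiv Language.graph V W G.structure H.structure) : G ≃g H :=
  letI := G.structure
  letI := H.structure
  ⟨e.toEquiv, fun {x y} => e.map_rel adj ![x, y]⟩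

/-- An isomorphism of graphs as an isomorphism of first-order structures. -/
def equivOfIso {V W : Type*} {G : SimpleGraph V} {H : SimpleGraph W} (e : G ≃g H) :
    @Language.Equiv Language.graph V W G.structure H.structure :=
  letI := G.structure
  letI := H.structure
  { e.toEquiv with
    map_fun' := fun f _ => isEmptyElim f
    map_rel' := fun r x => by
      cases r
      exact e.map_adj_iff }

lemma Aleph0Categorical.nonempty_iso (h : Aleph0Categorical (TStar C)) {V W : Type}
    {G : SimpleGraph V} {H : SimpleGraph W} (hG : IsExistentiallyComplete C G)
    (hH : IsExistentiallyComplete C H) : Nonempty (G ≃g H) := by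
  let := G.structure
  let := H.structure
  obtain ⟨e⟩ := h.2 V W hG.1.1 hH.1.1 hG.model hH.model
  exact ⟨isoOfEquiv e⟩

lemma finite_typeSpace_of_one (h : ∃ F ∈ C, F.1 = 1) (n : ℕ) : (typeSpace C n).Finite := by
  refine Set.Subsingleton.finite ?_
  rintro _ ⟨V, G, a, hG, rfl⟩ _ ⟨W, H, b, hH, rfl⟩
  have := isEmpty_of_omits hG.1.2 h
  have := isEmpty_of_omits hH.1.2 h
  exact existentialType_eq_iff.2
    ⟨fun _ _ => ⟨isEmptyElim, fun x => isEmptyElim x, fun i => isEmptyElim (a i)⟩,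
      fun _ _ => ⟨isEmptyElim, fun x => isEmptyElim x, fun i => isEmptyElim (b i)⟩⟩

/-- If there are infinitely many types, then the limit of some sequence of tuples with different
types exists. -/
lemma exists_limit_of_infinite (hfin : C.Finite) (hconn : ∀ F ∈ C, F.2.Connected) {n : ℕ}
    (h : (typeSpace C n).Infinite) :
    ∃ (V : ℕ → Type) (G : ∀ i, SimpleGraph (V i)) (a : ∀ i, Fin n → V i)
      (N : Type) (K : SimpleGraph N) (lift : N → ∀ i, V i) (c : Fin n → N),
      (∀ i, IsExistentiallyComplete C (G i)) ∧
      (∀ p : ℕ → Prop, (∀ᶠ i in Filter.hyperfilter ℕ, p i) → ∃ i j, p i ∧ p j ∧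
        existentialType (G i) (a i) ≠ existentialType (G j) (a j)) ∧
      IsExistentiallyComplete C K ∧
      (∀ᶠ i in Filter.hyperfilter ℕ, ∀ l, lift (c l) i = a i l) ∧
      ∀ {α : Type} (φ : Language.graph.Formula α) (v : α → N), Holds K φ v →
        ∀ᶠ i in Filter.hyperfilter ℕ, Holds (G i) φ fun x => lift (v x) i := by
  have hC : ∀ F ∈ C, F.1 ≠ 1 := fun F hF h1 => h (finite_typeSpace_of_one ⟨F, hF, h1⟩ n)
  let t := h.natEmbedding
  choose V G a hG ht using fun i => (t i).2
  obtain ⟨N, K, lift, c, hK, hc, hφ⟩ := exists_limit hfin hconn hC hG a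
  refine ⟨V, G, a, N, K, lift, c, hG, fun p hp => ?_, hK, Filter.eventually_all.2 hc,
    fun φ v => (hφ φ v).1⟩
  have hinf : {i | p i}.Infinite := fun hf => hf.notMem_hyperfilter hp
  obtain ⟨i, hi, j, hj, hij⟩ := hinf.nontrivial
  refine ⟨i, j, hi, hj, ?_⟩
  rw [← ht, ← ht]
  exact fun he => hij (t.injective (Subtype.ext he))

lemma finite_typeSpace_of_categorical (hfin : C.Finite) (hconn : ∀ F ∈ C, F.2.Connected)
    (h : Aleph0Categorical (TStar C)) (n : ℕ) : (typeSpace C n).Finite := by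
  by_contra hinf
  obtain ⟨V, G, a, N, K, lift, c, hG, htwo, hK, hc, hφ⟩ := exists_limit_of_infinite hfin hconn hinf
  obtain ⟨S, hS, hSiso⟩ := exists_isolating hconn c fun W H hH => h.nonempty_iso hK hH
  have := hS.to_subtype
  have hev := hφ (embF K c S) c ((holds_embF id).2 ⟨id, embOn_id _, fun _ => rfl⟩)
  obtain ⟨i, j, hi, hj, hne⟩ :=
    htwo (fun i => existentialType (G i) (a i) = existentialType K c) <| by
      filter_upwards [hev, hc] with i hi hci
      simp only [hci] at hi
      have hne : Nonempty N → Nonempty (V i) := fun ⟨x⟩ => ⟨lift x i⟩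
      obtain ⟨e, he, hea⟩ := (holds_embF hne).1 hi
      have hloc := hSiso _ (G i) (a i) (hG i) ⟨e, he.mono Set.subset_union_left, hea⟩
      exact existentialType_eq_iff.2 ⟨hloc, (hG i).loc_symm hK.1 hloc⟩
  exact hne (hi.trans hj.symm)

lemma acl_finite_of_equiv {M : Type*} {N : Type*} [Language.graph.Structure M]
    [Language.graph.Structure N] (g : M ≃[Language.graph] N) {A : Set M}
    (h : (acl (g '' A)).Finite) : (acl A).Finite := by
  refine Set.Finite.of_injOn (f := g) ?_ g.injective.injOn h
  rintro b ⟨n, φ, p, hφ, hp, hfin, hb⟩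
  have key : ∀ x, φ.Realize (Fin.cons (g x) (g ∘ p) : Fin (n + 1) → N) ↔
      φ.Realize (Fin.cons x p : Fin (n + 1) → M) := fun x => by
    rw [← Fin.comp_cons, StrongHomClass.realize_formula g φ]
  refine ⟨n, φ, g ∘ p, hφ, fun i => ⟨p i, hp i, rfl⟩, (hfin.image g).subset fun y hy => ?_,
    (key b).2 hb⟩
  obtain ⟨x, rfl⟩ := g.surjective y
  exact ⟨x, (key x).1 hy, rfl⟩

lemma finite_typeSpace_of_acl (hfin : C.Finite) (hconn : ∀ F ∈ C, F.2.Connected)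
    (h : ∀ (M : Type u) [Language.graph.Structure M], M ⊨ TStar C →
      ∀ A : Set M, A.Finite → (acl A).Finite) (n : ℕ) : (typeSpace C n).Finite := by
  by_contra hinf
  obtain ⟨V, G, a, N, K, lift, c, hG, htwo, hK, hc, hφ⟩ := exists_limit_of_infinite hfin hconn hinf
  have hcfin := Set.finite_range c
  have hacl : (aclSet K (Set.range c)).Finite := by
    let := K.structure
    -- The hypothesis concerns structures in universe `u`, while `N` lives in `Type`.
    let : Language.graph.Structure (ULift.{u} N) := Equiv.ulift.symm.inducedStructure
    let g : N ≃[Language.graph] ULift.{u} N := Equiv.ulift.symm.inducedStructureEquiv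
    have hN : N ⊨ TStar C := hK.model
    exact (acl_finite_of_equiv g (h _ (StrongHomClass.theory_model g) _ (hcfin.image g))).subset
      (aclSet_subset_acl hcfin)
  obtain ⟨k, d, -, hd⟩ := hacl.fin_param
  have hclosed : aclSet K (Set.range d) ⊆ Set.range d := by
    rw [hd]
    exact aclSet_aclSet_subset hK hcfin hacl
  choose σ hσ using fun l => (hd ▸ subset_aclSet hcfin ⟨l, rfl⟩ : c l ∈ Set.range d)
  have := hfin.to_subtype
  have hlook := hφ (lookF C K d) d
    (holds_lookF.2 ⟨fun _ _ => ⟨Iff.rfl, Iff.rfl⟩, fun _ _ _ => Iff.rfl⟩)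
  have havoid : ∀ᶠ i in Filter.hyperfilter ℕ, ∀ p : Σ F : C, (Fin F.1.1 → Fin k ⊕ Bool),
      HasPart p.1.1.2 p.2 K d → AvoidsPart p.1.1.2 p.2 (G i) fun x => lift (d x) i := by
    rw [Filter.eventually_all]
    intro p
    by_cases hp : HasPart p.1.1.2 p.2 K d
    · exact (hφ _ d (holds_avoidsPartF.2 (avoidsPart_of_aclSet_subset hclosed hp))).mono
        fun i hi _ => holds_avoidsPartF.1 hi
    · exact Filter.Eventually.of_forall fun i h => absurd h hp
  obtain ⟨i, j, ⟨hi, hia, hic⟩, ⟨hj, -, hjc⟩, hne⟩ := htwo _ (hlook.and (havoid.and hc))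
  obtain ⟨hdi, hpi⟩ := holds_lookF.1 hi
  obtain ⟨hdj, hpj⟩ := holds_lookF.1 hj
  have hdij : SameDiag (G i) (fun x => lift (d x) i) (G j) fun x => lift (d x) j := fun x y =>
    ⟨(hdi x y).1.symm.trans (hdj x y).1, (hdi x y).2.symm.trans (hdj x y).2⟩
  -- A part found in `G j` is found in `K`, since the two look alike over `d`; there it can avoid
  -- finite sets, and this first-order property passes to `G i`.
  have hloc := loc_of_omits_freeAmalgam (hG i).1 (hG j) hdij
    (omits_freeAmalgam (hG i).1.2 hdij fun F hF l hl => hia ⟨⟨F, hF⟩, l⟩ ((hpj F hF l).2 hl))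
  have hloc' := hloc.reindex σ
  simp only [Function.comp_def, hσ, hic, hjc] at hloc'
  exact hne (existentialType_eq_iff.2 ⟨hloc', (hG i).loc_symm (hG j).1 hloc'⟩)

lemma acl_finite_of_finite_typeSpace (hfin : C.Finite) (hconn : ∀ F ∈ C, F.2.Connected)
    (h : ∀ n, (typeSpace C n).Finite) {M : Type*} [Language.graph.Structure M] (hM : M ⊨ TStar C)
    {A : Set M} (hA : A.Finite) : (acl A).Finite := by
  by_contra hinf
  obtain ⟨n, p, -, rfl⟩ := hA.fin_param
  let b := Set.Infinite.natEmbedding _ hinf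
  obtain ⟨N, G, j, hG, hs, hj⟩ := exists_elementary_subgraph hfin hconn hM
    ((Set.countable_range p).union (Set.countable_range fun i => (b i : M)))
  choose p' hp' using fun i => hs (Or.inl ⟨i, rfl⟩)
  choose b' hb' using fun i => hs (Or.inr ⟨i, rfl⟩)
  have := (h (n + 1)).to_subtype
  let τ : ℕ → typeSpace C (n + 1) := fun i =>
    ⟨existentialType G (Fin.cons (b' i) p' : Fin (n + 1) → N), N, G, _, hG, rfl⟩
  obtain ⟨t, ht⟩ := Finite.exists_infinite_fiber τ
  have ht' : (τ ⁻¹' {t}).Infinite := Set.infinite_coe_iff.1 ht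
  obtain ⟨i₀, hi₀⟩ := ht'.nonempty
  obtain ⟨m, φ, q, hφ, hq, hqfin, hqb⟩ := (b i₀).2
  choose σ hσ using hq
  have key : ∀ i, φ.Realize (Fin.cons (b i : M) q : Fin (m + 1) → M) ↔
      Sat G φ ((Fin.cons (b' i) p' : Fin (n + 1) → N) ∘ (Fin.cons 0 (Fin.succ ∘ σ) :
        Fin (m + 1) → Fin (n + 1))) := fun i => by
    refine Iff.trans (iff_of_eq (congrArg _ ?_)) (hj φ _).symm
    funext x
    refine Fin.cases ?_ (fun x => ?_) x
    · simp [hb']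
    · simp [hp', hσ]
  refine (ht'.image (f := fun i => (b i : M)) fun i _ i' _ hii =>
    b.injective (Subtype.ext hii)) (hqfin.subset ?_)
  rintro _ ⟨i, hi, rfl⟩
  have heq : existentialType G (Fin.cons (b' i₀) p' : Fin (n + 1) → N) =
      existentialType G (Fin.cons (b' i) p' : Fin (n + 1) → N) :=
    congrArg Subtype.val ((show τ i₀ = t from hi₀).trans (show τ i = t from hi).symm)
  exact (key i).2 (((existentialType_eq_iff.1 heq).1.reindex _).sat hφ ((key i₀).1 hqb))

/-- Any two existentially complete graphs have the same existential sentences. -/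
lemma loc_elim0 (hconn : ∀ F ∈ C, F.2.Connected) {V W : Type} {G : SimpleGraph V}
    {H : SimpleGraph W} (hG : IsExistentiallyComplete C G) (hH : IsExistentiallyComplete C H)
    (a : Fin 0 → V) (b : Fin 0 → W) : Loc G a H b := by
  have hd : SameDiag G a H b := fun i => i.elim0
  refine loc_of_omits_freeAmalgam hG.1 hH hd ?_
  rintro F hF hc
  obtain ⟨l, h₁, h₂, hr₁, hr₂, hx⟩ := exists_realizes_of_isContained hd hc
  have hcon := hconn F hF
  obtain ⟨x₀⟩ := hcon.nonempty
  -- Without marked vertices, a connected graph cannot be split between the two factors.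
  have hconst : ∀ y, l y = l x₀ := fun y => by
    obtain ⟨w⟩ := hcon.preconnected y x₀
    induction w with
    | nil => rfl
    | @cons u v _ huv _ ih =>
      rw [← ih]
      have h1 := hx u v huv
      have h2 := hx v u huv.symm
      rcases hu : l u with i | s
      · exact i.elim0
      rcases hv : l v with i | s'
      · exact i.elim0
      rw [hu, hv] at h1 h2
      cases s <;> cases s' <;> simp_all
  rcases hl : l x₀ with i | s
  · exact i.elim0
  have hs : ∀ x, l x ≠ Sum.inr (!s) := fun x h => by
    rw [hconst, hl] at h
    cases s <;> cases h
  cases s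
  · exact hG.1.2 F hF (isContained_of_injective (fun x => h₁ ⟨x, hs x⟩) (fun x y hxy =>
      by_contra fun hne => hr₁.1 _ _ (fun h => hne (congrArg Subtype.val h)) hxy)
      fun x y hxy => hr₁.2.1 ⟨x, _⟩ ⟨y, _⟩ hxy)
  · exact hH.1.2 F hF (isContained_of_injective (fun x => h₂ ⟨x, hs x⟩) (fun x y hxy =>
      by_contra fun hne => hr₂.1 _ _ (fun h => hne (congrArg Subtype.val h)) hxy)
      fun x y hxy => hr₂.2.1 ⟨x, _⟩ ⟨y, _⟩ hxy)

/-- For each of the finitely many types not containing that of `(v, a)`, a finite piece of `G`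
witnesses the difference. An embedding of the union of these pieces leaves only types containing it
for the image. -/
lemma Loc.exists_cons {V W : Type} {G : SimpleGraph V} {H : SimpleGraph W}
    (hH : IsExistentiallyComplete C H) {n : ℕ} (hfin : (typeSpace C (n + 1)).Finite)
    {a : Fin n → V} {b : Fin n → W} (h : Loc G a H b) (v : V) :
    ∃ w, Loc G (Fin.cons v a : Fin (n + 1) → V) H (Fin.cons w b : Fin (n + 1) → W) := by
  classical
  set a' : Fin (n + 1) → V := Fin.cons v a with ha'
  have hex : ∀ q : Set (Language.graph.Formula (Fin (n + 1))), ∃ S : Set V, S.Finite ∧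
      ∀ c : Fin (n + 1) → W, existentialType H c = q →
        (∃ e, EmbOn G H S e ∧ e ∘ a' = c) → existentialType G a' ⊆ q := by
    intro q
    by_cases hq : existentialType G a' ⊆ q
    · exact ⟨∅, Set.finite_empty, fun _ _ _ => hq⟩
    · obtain ⟨φ, ⟨hφ, hs⟩, hφq⟩ := Set.not_subset.1 hq
      obtain ⟨S, hS, hSe⟩ := exists_finite_witness_sat hφ hs
      refine ⟨S, hS, fun c hc ⟨e, he, hec⟩ => absurd ?_ hφq⟩
      rw [← hc, ← hec]
      exact ⟨hφ, hSe H e he⟩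
  choose S hS hSq using hex
  obtain ⟨e, he, hea⟩ := h (⋃ q ∈ typeSpace C (n + 1), S q) (hfin.biUnion fun q _ => hS q)
  refine ⟨e v, existentialType_subset_iff.1 (hSq _ _ rfl ⟨e, he.mono ?_, ?_⟩)⟩
  · exact Set.subset_biUnion_of_mem (u := S) ⟨W, H, _, hH, rfl⟩
  · rw [ha', Fin.comp_cons]
    exact congrArg _ (funext hea)

/-- A finite partial isomorphism preserving existential types. -/
structure PartialIso {V W : Type} (G : SimpleGraph V) (H : SimpleGraph W) where
  length : ℕ
  left : Fin length → V
  right : Fin length → W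
  loc : Loc G left H right

instance {V W : Type} {G : SimpleGraph V} {H : SimpleGraph W} : Preorder (PartialIso G H) where
  le s t := ∃ σ : Fin s.length → Fin t.length, s.left = t.left ∘ σ ∧ s.right = t.right ∘ σ
  le_refl _ := ⟨id, rfl, rfl⟩
  le_trans := fun _ _ _ ⟨σ, h₁, h₂⟩ ⟨τ, h₃, h₄⟩ => ⟨τ ∘ σ, by rw [h₁, h₃]; rfl, by rw [h₂, h₄]; rfl⟩

/-- Back-and-forth, organized as a generic directed family of partial isomorphisms; the backward
step uses the symmetry of `Loc` between existentially complete graphs. -/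
lemma nonempty_iso_of_finite_typeSpace (hconn : ∀ F ∈ C, F.2.Connected)
    (h : ∀ n, (typeSpace C n).Finite) {V W : Type} {G : SimpleGraph V} {H : SimpleGraph W}
    (hG : IsExistentiallyComplete C G) (hH : IsExistentiallyComplete C H) : Nonempty (G ≃g H) := by
  have := hG.1.1
  have := hH.1.1
  have : Encodable (V ⊕ W) := Encodable.ofCountable _
  let D : V ⊕ W → Order.Cofinal (PartialIso G H) := Sum.elim
    (fun v => ⟨{s | v ∈ Set.range s.left}, fun s => by
      obtain ⟨w, hw⟩ := s.loc.exists_cons hH (h _) v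
      exact ⟨⟨_, _, _, hw⟩, ⟨0, rfl⟩, Fin.succ, rfl, rfl⟩⟩)
    fun w => ⟨{s | w ∈ Set.range s.right}, fun s => by
      obtain ⟨v, hv⟩ := (hG.loc_symm hH.1 s.loc).exists_cons hG (h _) w
      exact ⟨⟨_, _, _, hH.loc_symm hG.1 hv⟩, ⟨0, rfl⟩, Fin.succ, rfl, rfl⟩⟩
  let s₀ : PartialIso G H := ⟨0, Fin.elim0, Fin.elim0, loc_elim0 hconn hG hH _ _⟩
  let I := Order.idealOfCofinals s₀ D
  let R : V → W → Prop := fun v w => ∃ s ∈ I, ∃ i, s.left i = v ∧ s.right i = w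
  have hR : ∀ {v w v' w'}, R v w → R v' w' → (v = v' ↔ w = w') ∧ (G.Adj v v' ↔ H.Adj w w') := by
    rintro _ _ _ _ ⟨s, hs, i, rfl, rfl⟩ ⟨s', hs', i', rfl, rfl⟩
    obtain ⟨t, -, ⟨σ, h1, h2⟩, ⟨σ', h1', h2'⟩⟩ := I.directed s hs s' hs'
    rw [h1, h2, h1', h2']
    exact ⟨t.loc.eq_iff _ _, t.loc.adj_iff _ _⟩
  have hleft : ∀ v, ∃ w, R v w := fun v => by
    obtain ⟨s, ⟨i, hi⟩, hs⟩ := Order.cofinal_meets_idealOfCofinals s₀ D (Sum.inl v)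
    exact ⟨_, s, hs, i, hi, rfl⟩
  have hright : ∀ w, ∃ v, R v w := fun w => by
    obtain ⟨s, ⟨i, hi⟩, hs⟩ := Order.cofinal_meets_idealOfCofinals s₀ D (Sum.inr w)
    exact ⟨_, s, hs, i, rfl, hi⟩
  choose f hf using hleft
  choose g hg using hright
  exact ⟨⟨⟨f, g, fun v => (hR (hg (f v)) (hf v)).1.2 rfl, fun w => (hR (hf (g w)) (hg w)).1.1 rfl⟩,
    fun {v v'} => (hR (hf v) (hf v')).2.symm⟩⟩

lemma exists_existentiallyComplete (hconn : ∀ F ∈ C, F.2.Connected) :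
    ∃ (V : Type) (G : SimpleGraph V), IsExistentiallyComplete C G := by
  obtain ⟨V, G, hG, -⟩ := exists_existentiallyComplete_extension (H := (⊥ : SimpleGraph Empty))
    hconn ⟨inferInstance, fun F hF hc => by
      obtain ⟨h, -⟩ := exists_injective_of_isContained hc
      exact (h (hconn F hF).nonempty.some).elim⟩
  exact ⟨V, G, hG⟩

lemma categorical_of_finite_typeSpace (hfin : C.Finite) (hconn : ∀ F ∈ C, F.2.Connected)
    (h : ∀ n, (typeSpace C n).Finite) : Aleph0Categorical (TStar C) := by
  refine ⟨?_, fun M N instM instN _ _ hM hN => ?_⟩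
  · obtain ⟨V, G, hG⟩ := exists_existentiallyComplete hconn
    exact ⟨V, G.structure, hG.1.1, hG.model⟩
  · obtain ⟨G, rfl, hG⟩ := exists_graph_of_model hfin hconn hM
    obtain ⟨H, rfl, hH⟩ := exists_graph_of_model hfin hconn hN
    exact (nonempty_iso_of_finite_typeSpace hconn h hG hH).map equivOfIso

lemma exists_universal_of_categorical (hconn : ∀ F ∈ C, F.2.Connected)
    (h : Aleph0Categorical (TStar C)) :
    ∃ (V : Type) (G : SimpleGraph V), IsUniversalFree C G := by
  obtain ⟨V, G, hG⟩ := exists_existentiallyComplete hconn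
  refine ⟨V, G, hG.1, fun W H hH => ?_⟩
  obtain ⟨X, K, hK, ⟨f⟩⟩ := exists_existentiallyComplete_extension hconn hH
  obtain ⟨e⟩ := h.nonempty_iso hK hG
  exact ⟨e.toEmbedding.comp f⟩

end Categoricity
end ForbiddenGraphs

theorem theorem3 (C : Set ForbiddenGraphs.FiniteGraph) (hfin : C.Finite)
    (hconn : ∀ F ∈ C, F.2.Connected) :
    List.TFAE [
      ForbiddenGraphs.Aleph0Categorical (ForbiddenGraphs.TStar C),
      ∀ n : ℕ, (ForbiddenGraphs.typeSpace C n).Finite,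
      ∀ (M : Type*) [Language.graph.Structure M], M ⊨ ForbiddenGraphs.TStar C →
        ∀ A : Set M, A.Finite → (ForbiddenGraphs.acl A).Finite] ∧
    (ForbiddenGraphs.Aleph0Categorical (ForbiddenGraphs.TStar C) →
      ∃ (V : Type) (G : SimpleGraph V), ForbiddenGraphs.IsUniversalFree C G) := by
  refine ⟨?_, ForbiddenGraphs.exists_universal_of_categorical hconn⟩
  tfae_have 1 → 2 := ForbiddenGraphs.finite_typeSpace_of_categorical hfin hconn
  tfae_have 2 → 1 := ForbiddenGraphs.categorical_of_finite_typeSpace hfin hconn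
  tfae_have 2 → 3 := fun h M _ hM A hA =>
    ForbiddenGraphs.acl_finite_of_finite_typeSpace hfin hconn h hM hA
  tfae_have 3 → 2 := ForbiddenGraphs.finite_typeSpace_of_acl hfin hconn
  tfae_finish
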